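/- **Setting.** Let $(X,\mu)$ be a probability space and let $\mathcal H$ be a reproducing kernel Hilbert space of real functions on $X$ whose kernel has the Mercer expansion $k(x,y)=\sum_{\ell\ge 1}\lambda_\ell v_\ell(x)v_\ell(y)$ for all $x,y\in X$, where $\lambda_1\ge\lambda_2\ge\dots\ge 0$ and the measurable functions $v_\ell$ with $\lambda_\ell>0$ are orthonormal in $L_2(X,\mu)$ (they need not be complete in $L_2$). Assume that, under $x\sim\mu$, the features $v_\ell(x)$ with $\lambda_\ell>0$ are independent, have mean zero, and are sub-Gaussian with a common variance proxy $\sigma^2$, i.e. $\mathbb E\,e^{t v_\ell(x)}\le e^{\sigma^2t^2/2}$ for all $t\in\mathbb R$. Fix $p$, let $G=\operatorname{span}(v_1,\dots,v_p)$, let $\mathcal T_G$ be the operator on $G$ (with the $L_2$ inner product) with $\mathcal T_Gv_\ell=\lambda_\ell v_\ell$, and let $\eta^*\in G$. Let $n\ge1$ and let $(x_1,y_1),\dots,(x_n,y_n)$ be i.i.d. with $x_i\sim\mu$, $y_i\in\{-1,1\}$ and $\mathbb E[y_i\mid x_i]=\eta^*(x_i)$. Let $\mathcal A:\mathcal H\to\mathbb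 R^n$, $(\mathcal Af)_i=f(x_i)$, be the sampling operator, $\mathcal R=\mathcal A\mathcal P_{G^\perp}$ its restriction to the orthogonal complement of $G$ in $\mathcal H$, and for each $i$ let $\mathcal C_{\setminus i}:G\to\mathbb R^{n-1}$ be the sampling operator on $G$ for the data set without $x_i$, with adjoint $\mathcal C_{\setminus i}^*$ taken with respect to the $L_2$ inner product on $G$. **Assumption 1** (with parameters $0<\delta<1/2$, $\alpha_L>0$, $\alpha_U$, $c\le 1/2$, $\kappa>0$). With probability at least $1-\delta$ the training points satisfy both (1) $\alpha_LI_n\preccurlyeq\mathcal R\mathcal R^*\preccurlyeq\alpha_UI_n$, and (2) $\dfrac{\alpha_U-\alpha_L}{\alpha_U+\alpha_L}+\dfrac2n\big\|\mathcal C_{\setminus i}^*\mathcal C_{\setminus i}-n\mathcal I_G\big\|_{L_2}\le c$ for all $i\in\{1,\dots,n\}$. Moreover, (3) with $\bar\alpha=\frac{2\alpha_L\alpha_U}{\alpha_L+\alpha_U}$, $\bar{\mathcal S}=n\mathcal T_G(\bar\alpha\mathcal I_G+n\mathcal T_G)^{-1}$ and $\bar{\mathcal B}=\mathcal I_G-\bar{\mathcal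 S}$, the functions $\bar{\mathcal B}\eta^*$ and $\bar{\mathcal S}\eta^*$ are essentially bounded and $$b:=\|\bar{\mathcal B}\eta^*\|_\infty\le\kappa\,\big(1-\|\bar{\mathcal S}\eta^*\|_\infty\big).$$ **Theorem.** For all $\sigma^2$ and $\kappa>0$ there is a constant $\varepsilon>0$, depending only on $\sigma^2$ and $\kappa$, such that the following holds in the setting above. If Assumption 1 holds, $b>0$, and $$\frac1b\sqrt{\frac{p\log n}{n}}+\frac{\alpha_U-\alpha_L}{\alpha_U+\alpha_L}\cdot\frac{\sqrt{\log n}}{b}+\sqrt{\frac{\lambda_{p+1}\,n\log n}{\alpha_L}}+c\sqrt{\log n}\le\varepsilon ,$$ then, with probability at least $1-\delta-ne^{-p}-\frac3n$, the minimum-norm interpolation problem $$\min_{\eta\in\mathcal H}\|\eta\|_{\mathcal H}\quad\text{s.t. } \eta(x_i)=y_i,\ i=1,\dots,n,$$ and the hard-margin kernel SVM problem $$\min_{\eta\in\mathcal H}\|\eta\|_{\mathcal H}\quad\text{s.t. } y_i\,\eta(x_i)\ge1,\ i=1,\dots,n,$$ each have exactly one solution, and the two solutions are equal. -/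

import Mathlib

open MeasureTheory ProbabilityTheory
open scoped ENNReal NNReal

noncomputable section

namespace SVP

/-! Kernel features.  Indices start at `0`: `lam 0, …, lam (p - 1)` are the `p` leading
eigenvalues, and `lam p` is the next one. -/

section Features

variable {X : Type*}

/-- The scalar reproducing kernel `k(x, y)` of a real RKHS `H` of functions on `X`. -/
def kern (H : Type*) [NormedAddCommGroup H] [InnerProductSpace ℝ H] [CompleteSpace H]
    [RKHS ℝ H X ℝ] (x y : X) : ℝ :=
  RKHS.kernel H x y 1

/-- The kernel of `H` has the Mercer expansion `k(x, y) = ∑ ℓ, lam ℓ * v ℓ x * v ℓ y` with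
nonnegative nonincreasing eigenvalues `lam` and eigenfunctions `v`, orthonormal in `L²(μ)`.
Indices with `lam ℓ = 0` contribute nothing to the kernel and nothing is asked of `v ℓ` there but
measurability, so that a finite number of features is covered too.
(The eigenvalue equations `∫ k(x, y) v ℓ y dμ(y) = lam ℓ * v ℓ x` follow. The `v ℓ` are not
required to be complete in `L²(μ)`: independent centred features never span `L²(μ)`, as the
constant function `1` is orthogonal to all of them.) -/
structure IsMercerSystem (H : Type*) [NormedAddCommGroup H] [InnerProductSpace ℝ H]
    [CompleteSpace H] [RKHS ℝ H X ℝ] [MeasurableSpace X] (μ : Measure X)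
    (lam : ℕ → ℝ) (v : ℕ → X → ℝ) : Prop where
  nonneg : ∀ ℓ, 0 ≤ lam ℓ
  antitone : Antitone lam
  measurable : ∀ ℓ, Measurable (v ℓ)
  orthonormal : ∀ ℓ m, 0 < lam ℓ → 0 < lam m →
    ∫ x, v ℓ x * v m x ∂μ = if ℓ = m then 1 else 0
  hasSum : ∀ x y, HasSum (fun ℓ => lam ℓ * v ℓ x * v ℓ y) (kern H x y)

/-- The features (those with a nonzero eigenvalue) are independent, zero-mean and sub-Gaussian
with variance proxy `σ2` under `x ∼ μ`. -/
structure IndepSubGaussianFeatures [MeasurableSpace X] (μ : Measure X)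
    (lam : ℕ → ℝ) (v : ℕ → X → ℝ) (σ2 : ℝ≥0) : Prop where
  indep : iIndepFun (fun (ℓ : {ℓ : ℕ // 0 < lam ℓ}) => v ℓ) μ
  mean_zero : ∀ ℓ, 0 < lam ℓ → ∫ x, v ℓ x ∂μ = 0
  subGaussian : ∀ ℓ, 0 < lam ℓ → HasSubgaussianMGF (v ℓ) σ2 μ

/-- The function `∑ ℓ < p, a ℓ * v ℓ`. -/
def combine (v : ℕ → X → ℝ) {p : ℕ} (a : Fin p → ℝ) : X → ℝ :=
  fun x => ∑ ℓ : Fin p, a ℓ * v ℓ x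

/-- `G`, the span of the `p` leading eigenfunctions, as a space of functions on `X`. -/
def G (v : ℕ → X → ℝ) (p : ℕ) : Submodule ℝ (X → ℝ) :=
  Submodule.span ℝ (Set.range fun ℓ : Fin p => v ℓ)

/-- `G` as a subspace of the RKHS `H`: the elements of `H` which, as functions, lie in `G`. -/
def GH (H : Type*) [NormedAddCommGroup H] [InnerProductSpace ℝ H]
    [RKHS ℝ H X ℝ] (v : ℕ → X → ℝ) (p : ℕ) : Submodule ℝ H :=
  (G v p).comap (RKHS.coeCLM ℝ : H →L[ℝ] X → ℝ).toLinearMap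

/-- The sampling operator `A : H → ℝⁿ`, `(A f)_i = f (x_i)`. -/
def sampling (H : Type*) [NormedAddCommGroup H] [InnerProductSpace ℝ H]
    [RKHS ℝ H X ℝ] {n : ℕ} (x : Fin n → X) : H →L[ℝ] EuclideanSpace ℝ (Fin n) :=
  (EuclideanSpace.equiv (Fin n) ℝ).symm.toContinuousLinearMap ∘L
    ContinuousLinearMap.pi fun i =>
      (ContinuousLinearMap.proj (x i) : (X → ℝ) →L[ℝ] ℝ) ∘L (RKHS.coeCLM ℝ : H →L[ℝ] X → ℝ)

/-- The residual sampling operator `R = A P` with `P` the orthogonal projection of `H` onto the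
orthogonal complement of `G`. -/
def residual (H : Type*) [NormedAddCommGroup H] [InnerProductSpace ℝ H] [CompleteSpace H]
    [RKHS ℝ H X ℝ] (v : ℕ → X → ℝ) (p : ℕ) {n : ℕ} (x : Fin n → X) :
    H →L[ℝ] EuclideanSpace ℝ (Fin n) :=
  sampling H x ∘L (GH H v p)ᗮ.starProjection

/-- The residual Gram matrix `R R*`, as an operator on `ℝⁿ`. -/
def residualGram (H : Type*) [NormedAddCommGroup H] [InnerProductSpace ℝ H] [CompleteSpace H]
    [RKHS ℝ H X ℝ] (v : ℕ → X → ℝ) (p : ℕ) {n : ℕ} (x : Fin n → X) :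
    EuclideanSpace ℝ (Fin n) →L[ℝ] EuclideanSpace ℝ (Fin n) :=
  residual H v p x ∘L ContinuousLinearMap.adjoint (residual H v p x)

/-! Operators on `G` with the `L²(μ)` inner product are written as matrices in the orthonormal
basis `v 0, …, v (p - 1)`. -/

/-- The leave-one-out sampling operator on `G`, without the point `x i`. -/
def looSampling (v : ℕ → X → ℝ) (p : ℕ) {n : ℕ} (x : Fin n → X) (i : Fin n) :
    Matrix {j : Fin n // j ≠ i} (Fin p) ℝ :=
  Matrix.of fun j ℓ => v ℓ (x j)

/-- The `L²` operator norm of `C* C - n I` on `G`, for the leave-one-out sampling operator `C`. -/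
def looDeviation (v : ℕ → X → ℝ) (p : ℕ) {n : ℕ} (x : Fin n → X) (i : Fin n) : ℝ :=
  ‖Matrix.toEuclideanCLM (n := Fin p) (𝕜 := ℝ)
    ((looSampling v p x i).transpose * looSampling v p x i - (n : ℝ) • 1)‖

/-- The kernel integral operator on `G`. -/
def TG (lam : ℕ → ℝ) (p : ℕ) : Matrix (Fin p) (Fin p) ℝ :=
  Matrix.diagonal fun ℓ => lam ℓ

/-- The harmonic mean of `αL` and `αU`. -/
def harmonicMean (αL αU : ℝ) : ℝ := 2 * αL * αU / (αL + αU)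

/-- The idealized survival operator `n T_G (ᾱ I + n T_G)⁻¹`, `ᾱ` the harmonic mean. -/
def survival (lam : ℕ → ℝ) (p n : ℕ) (αL αU : ℝ) : Matrix (Fin p) (Fin p) ℝ :=
  ((n : ℝ) • TG lam p) * (harmonicMean αL αU • 1 + (n : ℝ) • TG lam p)⁻¹

/-- The idealized bias operator. -/
def bias (lam : ℕ → ℝ) (p n : ℕ) (αL αU : ℝ) : Matrix (Fin p) (Fin p) ℝ :=
  1 - survival lam p n αL αU

/-- The essential supremum norm. -/
def supNorm [MeasurableSpace X] (μ : Measure X) (f : X → ℝ) : ℝ := (eLpNorm f ∞ μ).toReal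

/-- The idealized survival operator applied to `η = combine v a`. -/
def survivalFun (lam : ℕ → ℝ) (v : ℕ → X → ℝ) {p : ℕ} (a : Fin p → ℝ) (n : ℕ) (αL αU : ℝ) :
    X → ℝ :=
  combine v ((survival lam p n αL αU).mulVec a)

/-- The idealized bias operator applied to `η = combine v a`. -/
def biasFun (lam : ℕ → ℝ) (v : ℕ → X → ℝ) {p : ℕ} (a : Fin p → ℝ) (n : ℕ) (αL αU : ℝ) :
    X → ℝ :=
  combine v ((bias lam p n αL αU).mulVec a)

end Features

section Learning

variable {X Ω : Type*}

/-- `(x i, y i)`, `i < n`, are independent, with `x i ∼ μ`, `y i ∈ {-1, 1}` and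
`E[y i | x i] = η (x i)`; in particular they are identically distributed. -/
structure IsSample [MeasurableSpace X] [MeasurableSpace Ω] (P : Measure Ω) (μ : Measure X)
    (η : X → ℝ) {n : ℕ} (x : Fin n → Ω → X) (y : Fin n → Ω → ℝ) : Prop where
  measurable_x : ∀ i, Measurable (x i)
  measurable_y : ∀ i, Measurable (y i)
  indep : iIndepFun (fun i ω => (x i ω, y i ω)) P
  law : ∀ i, P.map (x i) = μ
  label : ∀ i, ∀ᵐ ω ∂P, y i ω = 1 ∨ y i ω = -1
  regression : ∀ i, P[y i | MeasurableSpace.comap (x i) inferInstance] =ᵐ[P] fun ω => η (x i ω)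

/-- With `η = combine v a ∈ G`: with probability at least `1 - δ` over the
training points, the residual Gram matrix lies between `αL I` and `αU I` and the leave-one-out
feature covariances concentrate with constant `c ≤ 1/2`; and the idealized bias is controlled
in `L∞` by `1 - ‖S̄ η‖_∞` up to the factor `κ` (both functions being essentially bounded).
As `n ≥ 1`, `covariance` and `c ≤ 1/2` force `αU ≤ 3 αL`, so `αL` and `αU` are of the same order. -/
structure SamplingAssumption (H : Type*) [NormedAddCommGroup H] [InnerProductSpace ℝ H]
    [CompleteSpace H] [RKHS ℝ H X ℝ] [MeasurableSpace X] [MeasurableSpace Ω]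
    (P : Measure Ω) (μ : Measure X) (lam : ℕ → ℝ) (v : ℕ → X → ℝ) {p : ℕ} (a : Fin p → ℝ)
    {n : ℕ} (x : Fin n → Ω → X) (δ αL αU c κ : ℝ) : Prop where
  delta_pos : 0 < δ
  delta_lt : δ < 1 / 2
  alpha_pos : 0 < αL
  c_le : c ≤ 1 / 2
  concentration : 1 - δ ≤ P.real {ω |
    (αL • ContinuousLinearMap.id ℝ (EuclideanSpace ℝ (Fin n)) ≤ residualGram H v p (x · ω) ∧
      residualGram H v p (x · ω) ≤ αU • ContinuousLinearMap.id ℝ (EuclideanSpace ℝ (Fin n))) ∧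
    ∀ i, (αU - αL) / (αU + αL) + 2 / n * looDeviation v p (x · ω) i ≤ c}
  bias_bounded : MemLp (biasFun lam v a n αL αU) ∞ μ
  survival_bounded : MemLp (survivalFun lam v a n αL αU) ∞ μ
  bias_le : supNorm μ (biasFun lam v a n αL αU) ≤
    κ * (1 - supNorm μ (survivalFun lam v a n αL αU))

variable {H : Type*} [NormedAddCommGroup H] [InnerProductSpace ℝ H] [RKHS ℝ H X ℝ]

/-- `f` solves the minimum-norm interpolation problem for the data `(x i, y i)`. -/
def IsMNI {n : ℕ} (x : Fin n → X) (y : Fin n → ℝ) (f : H) : Prop :=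
  (∀ i, f (x i) = y i) ∧ ∀ g : H, (∀ i, g (x i) = y i) → ‖f‖ ≤ ‖g‖

/-- `f` solves the hard-margin kernel SVM problem for the data `(x i, y i)`. -/
def IsSVM {n : ℕ} (x : Fin n → X) (y : Fin n → ℝ) (f : H) : Prop :=
  (∀ i, 1 ≤ y i * f (x i)) ∧ ∀ g : H, (∀ i, 1 ≤ y i * g (x i)) → ‖f‖ ≤ ‖g‖

/-- Both problems have exactly one solution, and it is the same one. -/
def SolutionsCoincide (H : Type*) [NormedAddCommGroup H] [InnerProductSpace ℝ H]
    [RKHS ℝ H X ℝ] {n : ℕ} (x : Fin n → X) (y : Fin n → ℝ) : Prop :=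
  ∃ f : H, (∀ g : H, IsMNI x y g ↔ g = f) ∧ ∀ g : H, IsSVM x y g ↔ g = f

end Learning

end SVP

end

/-! Let $K$ be the kernel matrix of the sample. The minimum-norm interpolant is $\sum_j g_j
k(x_j,\cdot)$ with $Kg=y$, and by duality it also solves the SVM problem as soon as $y_ig_i\ge 0$
for all $i$ (`solutionsCoincide_of_dual`). A Schur complement gives $s\,g_i=y_i-t_i$ with $s>0$,
where $t_i$ is the prediction at $x_i$ of the interpolant trained without the $i$-th point. So it
suffices that $|t_i|<1$ for every $i$ (`ResGramBounds.solutionsCoincide`).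

The prediction $t_i$ is linear in the labels. Writing $y_j=\eta^*(x_j)+\text{noise}$ splits it into
a noise-free part, close to $\bar{\mathcal S}\eta^*(x_i)$, and a noise part. By assumption (3),
$|\bar{\mathcal S}\eta^*|\le 1-b/\kappa$ almost everywhere, so both errors together must stay below
$b/\kappa$; $\varepsilon$ is chosen so that they use at most half of it.

Noise-free part: $K=V\mathcal T_GV^*+R$, where $V$ holds the $p$ leading features. On the good event
$R$ acts like $\bar\alpha I$ and $V^*V$ like $nI$, so the learned function differs from
$\bar{\mathcal S}\eta^*$ by a combination of features with coefficient norm of order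
$(c+\sqrt{\lambda_{p+1}n/\alpha_L})\,b$ (`norm_bias_sub_le`, `ResGramBounds.errorBound_le`). The
left-out point is independent of the others and the features are independent and sub-Gaussian, so
evaluating this combination at $x_i$ costs only a factor $\sqrt{\log n}$
(`IsSample.measure_lt_abs_bias_le`).

Noise part: given all points, Hoeffding's inequality bounds it by $\sqrt{\log n}$ times the norm of
the interpolation weights, which is of order $\sqrt{p/n}+(\alpha_U-\alpha_L)/(\alpha_U+\alpha_L)$
(`ResGramBounds.norm_weights_le`). A union bound over $i$ finishes. -/

namespace SVP

/-! ### Perturbation bounds for positive operators -/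

section Operators

variable {E F : Type*} [NormedAddCommGroup E] [InnerProductSpace ℝ E]
  [NormedAddCommGroup F] [InnerProductSpace ℝ F]

/-- With $P=T-\alpha_L$ and $Q=\alpha_U-T$, which commute and are positive,
$PQ^2+QP^2=(\alpha_U-\alpha_L)PQ$. Both terms on the left are positive, so neither square roots nor
a spectral theorem are needed. -/
theorem inner_sub_smul_nonneg_of_lt (T : E →ₗ[ℝ] E) (hT : T.IsSymmetric) {αL αU : ℝ}
    (hL : ∀ w, αL * ‖w‖ ^ 2 ≤ inner ℝ (T w) w) (hU : ∀ w, inner ℝ (T w) w ≤ αU * ‖w‖ ^ 2)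
    (hlt : αL < αU) (g : E) : 0 ≤ inner ℝ (T g - αL • g) (αU • g - T g) := by
  have hA := hL (αU • g - T g)
  have hB := hU (T g - αL • g)
  have s1 : inner ℝ (T (T g)) g = inner ℝ (T g) (T g) := hT _ _
  have s2 : inner ℝ g (T g) = inner ℝ (T g) g := real_inner_comm _ _
  have s3 : inner ℝ (T g) (T (T g)) = inner ℝ (T (T g)) (T g) := real_inner_comm _ _
  simp only [← real_inner_self_eq_norm_sq, map_sub, map_smul, inner_sub_left, inner_sub_right,
    real_inner_smul_left, real_inner_smul_right, s1, s2] at hA hB ⊢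
  have hD : 0 < αU - αL := by linarith
  refine (mul_nonneg_iff_of_pos_left hD).1 ?_
  nlinarith

/-- `(T - αL)(αU - T)` is positive if `αL ≤ T ≤ αU`. -/
theorem inner_sub_smul_nonneg (T : E →ₗ[ℝ] E) (hT : T.IsSymmetric) {αL αU : ℝ}
    (hL : ∀ w, αL * ‖w‖ ^ 2 ≤ inner ℝ (T w) w) (hU : ∀ w, inner ℝ (T w) w ≤ αU * ‖w‖ ^ 2)
    (hle : αL ≤ αU) (g : E) : 0 ≤ inner ℝ (T g - αL • g) (αU • g - T g) := by
  have hg : 0 ≤ inner ℝ (T g - αL • g) g := by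
    have := hL g
    simp only [← real_inner_self_eq_norm_sq, inner_sub_left, real_inner_smul_left] at this ⊢
    linarith
  have key : ∀ t : ℝ, 0 < t →
      0 ≤ inner ℝ (T g - αL • g) (αU • g - T g) + t * inner ℝ (T g - αL • g) g := by
    -- The strict case applies after raising $\alpha_U$ by $t$; letting $t\to0$ covers
    -- $\alpha_L=\alpha_U$.
    intro t ht
    have := inner_sub_smul_nonneg_of_lt T hT hL (αU := αU + t)
      (fun w => (hU w).trans (by nlinarith [sq_nonneg ‖w‖])) (by linarith) g
    rw [← real_inner_smul_right, ← inner_add_right]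
    convert this using 2
    module
  by_contra! hneg
  set A := inner ℝ (T g - αL • g) (αU • g - T g)
  set B := inner ℝ (T g - αL • g) g
  have h := key (-A / (2 * (B + 1))) (by apply div_pos <;> linarith)
  have : -A / (2 * (B + 1)) * B ≤ -A / 2 := by
    rw [div_mul_eq_mul_div, div_le_div_iff₀ (by linarith) (by norm_num)]
    nlinarith
  linarith

/-- Positivity of $T(\alpha_U-T)$ says $\|Tg\|^2\le\alpha_U\langle Tg,g\rangle$; then
Cauchy–Schwarz. -/
theorem norm_apply_le_of_inner_le (T : E →ₗ[ℝ] E) (hT : T.IsSymmetric) {αU : ℝ}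
    (hL : ∀ w, 0 ≤ inner ℝ (T w) w) (hU : ∀ w, inner ℝ (T w) w ≤ αU * ‖w‖ ^ 2) (h0 : 0 ≤ αU)
    (g : E) : ‖T g‖ ≤ αU * ‖g‖ := by
  have h := inner_sub_smul_nonneg T hT (αL := 0) (by simpa using hL) hU h0 g
  have h2 := real_inner_le_norm (T g) g
  simp only [zero_smul, sub_zero, inner_sub_right, real_inner_smul_right,
    real_inner_self_eq_norm_sq] at h
  by_contra! hlt
  nlinarith [norm_nonneg (T g), norm_nonneg g, mul_nonneg h0 (norm_nonneg g)]

/-- `T⁻¹` is close to the inverse of the harmonic mean of the spectral bounds. -/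
theorem norm_sub_inv_harmonicMean_smul_le (T : E →ₗ[ℝ] E) (hT : T.IsSymmetric) {αL αU : ℝ}
    (hL : ∀ w, αL * ‖w‖ ^ 2 ≤ inner ℝ (T w) w) (hU : ∀ w, inner ℝ (T w) w ≤ αU * ‖w‖ ^ 2)
    (h0 : 0 < αL) (hle : αL ≤ αU) (g : E) :
    ‖g - (harmonicMean αL αU)⁻¹ • T g‖ ≤
      (αU - αL) / (αU + αL) * (harmonicMean αL αU)⁻¹ * ‖T g‖ := by
  have h := inner_sub_smul_nonneg T hT hL hU hle g
  have hU0 : 0 < αU := by linarith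
  -- The inverse harmonic mean is the midpoint of $[1/\alpha_U,1/\alpha_L]$, and this is half the
  -- length of that interval.
  have hc : (αU - αL) / (αU + αL) * (harmonicMean αL αU)⁻¹ = (αU - αL) / (2 * αL * αU) := by
    unfold harmonicMean; field_simp; ring
  have hh : (harmonicMean αL αU)⁻¹ = (αU + αL) / (2 * αL * αU) := by
    unfold harmonicMean; field_simp; ring
  rw [hc]
  refine abs_le_of_sq_le_sq' ?_ ?_ |>.2
  · rw [hh, norm_sub_sq_real, mul_pow, norm_smul, mul_pow, real_inner_smul_right,
      Real.norm_eq_abs, sq_abs]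
    simp only [inner_sub_left, inner_sub_right, real_inner_smul_left, real_inner_smul_right,
      real_inner_self_eq_norm_sq, real_inner_comm g (T g)] at h ⊢
    -- The gap between the two squares is exactly $\langle
    -- (T-\alpha_L)g,(\alpha_U-T)g\rangle/(\alpha_L\alpha_U)$.
    have e : ((αU - αL) / (2 * αL * αU)) ^ 2 * ‖T g‖ ^ 2 - (‖g‖ ^ 2
        - 2 * ((αU + αL) / (2 * αL * αU) * inner ℝ g (T g))
        + ((αU + αL) / (2 * αL * αU)) ^ 2 * ‖T g‖ ^ 2) =
        (αU * inner ℝ g (T g) - ‖T g‖ ^ 2 - αL * (αU * ‖g‖ ^ 2 - inner ℝ g (T g)))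
          / (αL * αU) := by
      field_simp; ring
    have : 0 ≤ (αU * inner ℝ g (T g) - ‖T g‖ ^ 2 - αL * (αU * ‖g‖ ^ 2 - inner ℝ g (T g)))
          / (αL * αU) := by
      apply div_nonneg _ (by positivity)
      linarith
    linarith
  · have : 0 ≤ αU - αL := by linarith
    positivity

section Regression

variable (V : F →ₗ[ℝ] E) (V' : E →ₗ[ℝ] F) (hV : ∀ u w, inner ℝ (V u) w = inner ℝ u (V' w))
  {N θ : ℝ} (hθ : ∀ u, ‖V' (V u) - N • u‖ ≤ θ * ‖u‖)

include hV hθ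

theorem abs_norm_sq_sub_le (u : F) : |‖V u‖ ^ 2 - N * ‖u‖ ^ 2| ≤ θ * ‖u‖ ^ 2 := by
  have : ‖V u‖ ^ 2 - N * ‖u‖ ^ 2 = inner ℝ u (V' (V u) - N • u) := by
    rw [inner_sub_right, ← hV, real_inner_smul_right, real_inner_self_eq_norm_sq,
      real_inner_self_eq_norm_sq]
  rw [this]
  refine (abs_real_inner_le_norm _ _).trans ?_
  nlinarith [hθ u, norm_nonneg u]

variable (T : E →ₗ[ℝ] E) (hT : T.IsSymmetric) {αL αU : ℝ}
  (hL : ∀ w, αL * ‖w‖ ^ 2 ≤ inner ℝ (T w) w) (hU : ∀ w, inner ℝ (T w) w ≤ αU * ‖w‖ ^ 2)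
  (h0 : 0 < αL) (hle : αL ≤ αU)

include hT hL hU h0 hle

/-- `V* T⁻¹ V` is close to a multiple of the identity. -/
theorem norm_adjoint_sub_smul_le {c : ℝ} (hN : 0 < N) (hθ0 : 0 ≤ θ)
    (hc : (αU - αL) / (αU + αL) + 2 / N * θ ≤ c) {g : E} {e : F} (hg : T g = V e) :
    ‖V' g - (N / harmonicMean αL αU) • e‖ ≤ c * N / harmonicMean αL αU * ‖e‖ := by
  have hU0 : 0 < αU := by linarith
  set β := (harmonicMean αL αU)⁻¹ with hβ
  have hβ0 : 0 < β := by rw [hβ]; unfold harmonicMean; positivity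
  set ρ := (αU - αL) / (αU + αL) with hρ
  have hρ0 : 0 ≤ ρ := div_nonneg (by linarith) (by linarith)
  have hρ1 : ρ ≤ 1 := by rw [hρ, div_le_one (by linarith)]; linarith
  have h1 := norm_sub_inv_harmonicMean_smul_le T hT hL hU h0 hle g
  rw [hg, ← hβ, ← hρ] at h1
  have hNθ : 0 ≤ N + θ := by positivity
  have hVu : ∀ u, ‖V u‖ ^ 2 ≤ (N + θ) * ‖u‖ ^ 2 := fun u => by
    linarith [(abs_le.1 (abs_norm_sq_sub_le V V' hV hθ u)).2]
  -- The adjoint inherits the bound on $V$: test $\|V'w\|^2=\langle VV'w,w\rangle$ and cancel one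
  -- factor $\|V'w\|^2$ after squaring.
  have hV' : ∀ w, ‖V' w‖ ^ 2 ≤ (N + θ) * ‖w‖ ^ 2 := fun w => by
    have h3 : ‖V' w‖ ^ 2 ≤ ‖V (V' w)‖ * ‖w‖ := by
      rw [← real_inner_self_eq_norm_sq, ← hV]; exact real_inner_le_norm _ _
    have h4 := hVu (V' w)
    have h5 : (‖V' w‖ ^ 2) ^ 2 ≤ ((N + θ) * ‖V' w‖ ^ 2) * ‖w‖ ^ 2 := by
      calc (‖V' w‖ ^ 2) ^ 2 ≤ (‖V (V' w)‖ * ‖w‖) ^ 2 := by gcongr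
        _ ≤ _ := by rw [mul_pow]; gcongr
    rcases (norm_nonneg (V' w)).eq_or_lt with h | h
    · rw [← h, zero_pow two_ne_zero]; positivity
    · have : 0 < ‖V' w‖ ^ 2 := by positivity
      nlinarith
  have h6 : ‖V' (g - β • V e)‖ ≤ (N + θ) * (ρ * β) * ‖e‖ := by
    apply abs_le_of_sq_le_sq' _ (by positivity) |>.2
    calc ‖V' (g - β • V e)‖ ^ 2 ≤ (N + θ) * ‖g - β • V e‖ ^ 2 := hV' _
      _ ≤ (N + θ) * (ρ * β * ‖V e‖) ^ 2 := by gcongr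
      _ = (N + θ) * (ρ * β) ^ 2 * ‖V e‖ ^ 2 := by ring
      _ ≤ (N + θ) * (ρ * β) ^ 2 * ((N + θ) * ‖e‖ ^ 2) := by gcongr; exact hVu e
      _ = _ := by ring
  have h7 : V' g - (N / harmonicMean αL αU) • e
      = V' (g - β • V e) + β • (V' (V e) - N • e) := by
    rw [map_sub, map_smul, div_eq_mul_inv, ← hβ]; module
  rw [h7]
  calc _ ≤ (N + θ) * (ρ * β) * ‖e‖ + β * (θ * ‖e‖) := by
        refine (norm_add_le _ _).trans (add_le_add h6 ?_)
        rw [norm_smul, Real.norm_of_nonneg hβ0.le]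
        gcongr; exact hθ e
    _ = ((N + θ) * ρ + θ) * β * ‖e‖ := by ring
    _ ≤ (c * N) * β * ‖e‖ := by
        gcongr
        -- Since $\rho\le1$, $(N+\theta)\rho+\theta\le N\rho+2\theta$; this is where the factor
        -- $2/N$ in front of $\theta$ comes from.
        have : (ρ + 2 / N * θ) * N ≤ c * N := by gcongr
        have h8 : (ρ + 2 / N * θ) * N = ρ * N + 2 * θ := by field_simp
        nlinarith
    _ = _ := by rw [hβ]; ring

/-- Size of the weights with which the labels enter the prediction at a left-out point. -/
theorem norm_weights_le (hN : 0 < N) (hθN : θ ≤ N / 4) (hU3 : αU ≤ 3 * αL)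
    {S : F →ₗ[ℝ] F} (hS : ∀ u, 0 ≤ inner ℝ (S u) u) {q r : E} {z : F}
    (hq : V (S (V' q)) + T q = V (S z) + r) :
    ‖q‖ ≤ 8 * (‖z‖ / √N) + ‖r‖ / αL := by
  have hU0 : 0 < αU := by linarith
  -- The equation becomes $Tq=Vu+r$. Positivity of $S$ gives $\langle Vu,q\rangle\le\langle
  -- u,z\rangle$, and the lower bound on $\|Vu\|$ controls $u$ by $q$ itself, so no bound on $S$ is
  -- needed.
  set u := S (z - V' q) with hu
  have hTq : T q = V u + r := by
    rw [hu, map_sub, map_sub]; rw [← sub_eq_zero] at hq ⊢; rw [← hq]; abel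
  have h1 : inner ℝ (V u) q ≤ ‖u‖ * ‖z‖ := by
    have := hS (z - V' q)
    rw [← hu, inner_sub_right, ← hV] at this
    linarith [real_inner_le_norm u z]
  have h2 : αL * ‖q‖ ^ 2 ≤ ‖u‖ * ‖z‖ + ‖r‖ * ‖q‖ := by
    have := hL q
    rw [hTq, inner_add_left] at this
    linarith [real_inner_le_norm r q]
  have h3 : ‖V u‖ ≤ αU * ‖q‖ + ‖r‖ := by
    have : V u = T q - r := by rw [hTq]; abel
    rw [this]
    refine (norm_sub_le _ _).trans (by
      gcongr
      exact norm_apply_le_of_inner_le T hT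
        (fun w => (by positivity : (0 : ℝ) ≤ αL * ‖w‖ ^ 2).trans (hL w)) hU hU0.le q)
  have h4 : (√N / 2 * ‖u‖) ^ 2 ≤ ‖V u‖ ^ 2 := by
    have := (abs_le.1 (abs_norm_sq_sub_le V V' hV hθ u)).1
    rw [mul_pow, div_pow, Real.sq_sqrt hN.le]
    nlinarith [sq_nonneg ‖u‖]
  have hs : 0 < √N := Real.sqrt_pos.2 hN
  have h5 : √N / 2 * ‖u‖ ≤ ‖V u‖ := abs_le_of_sq_le_sq' h4 (norm_nonneg _) |>.2
  set ν := ‖z‖ / √N with hν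
  set ρ := ‖r‖ / αL with hρ
  have hz : ‖z‖ = ν * √N := by rw [hν]; field_simp
  have hr : ‖r‖ = ρ * αL := by rw [hρ]; field_simp
  have hν0 : 0 ≤ ν := by positivity
  have hρ0 : 0 ≤ ρ := by positivity
  have h6 : ‖u‖ * ‖z‖ ≤ 2 * (3 * αL * ‖q‖ + ρ * αL) * ν := by
    have h7 : √N * ‖u‖ ≤ 2 * (3 * αL * ‖q‖ + ρ * αL) := by
      rw [hr] at h3
      have : αU * ‖q‖ ≤ 3 * αL * ‖q‖ := by gcongr
      linarith
    calc ‖u‖ * ‖z‖ = (√N * ‖u‖) * ν := by rw [hz]; ring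
      _ ≤ _ := by gcongr
  rw [hr] at h2
  -- If $\|q\|>8\nu+\rho$, then $\rho<\|q\|$ and the right side is at most
  -- $(8\nu+\rho)\|q\|<\|q\|^2$, a contradiction.
  have h8 : ‖q‖ ^ 2 ≤ 2 * (3 * ‖q‖ + ρ) * ν + ρ * ‖q‖ := by
    refine le_of_mul_le_mul_left ?_ h0
    nlinarith
  by_contra! hlt
  have hq0 := norm_nonneg q
  have : ρ < ‖q‖ := by linarith
  nlinarith

/-- Error of the regression function on noise-free labels, compared with its idealized version. -/
theorem norm_bias_sub_le {c : ℝ} (hN : 0 < N) (hθ0 : 0 ≤ θ) (hθN : θ ≤ N)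
    (hc : (αU - αL) / (αU + αL) + 2 / N * θ ≤ c) (hc2 : c ≤ 1 / 2)
    {S : F →ₗ[ℝ] F} (hS : ∀ u, 0 ≤ inner ℝ (S u) u) {g : E} {a e : F}
    (hg : V (S (V' g)) + T g = V a) (he : e + (N / harmonicMean αL αU) • S e = a) :
    ‖a - S (V' g) - e‖ ≤ 2 * c * ‖e‖ ∧ inner ℝ (T g) g ≤ 8 * N / αL * ‖e‖ ^ 2 := by
  have hU0 : 0 < αU := by linarith
  set t := N / harmonicMean αL αU with ht
  have ht0 : 0 < t := by rw [ht]; unfold harmonicMean; positivity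
  set f := a - S (V' g) with hf
  have hTg : T g = V f := by
    rw [hf, map_sub]; rw [← hg]; abel
  have h1 := norm_adjoint_sub_smul_le V V' hV hθ T hT hL hU h0 hle hN hθ0 hc hTg
  rw [mul_div_assoc, ← ht] at h1
  set z := V' g - t • f with hz
  -- The true error satisfies $f+SV'g=a$, the idealized one $e+tSe=a$; subtracting, and pairing with
  -- the argument of $S$, the positivity of $S$ gives $t\|f-e\|\le\|z\|$ whatever the size of $S$.
  have h2 : f - e = - S (t • (f - e) + z) := by
    have : t • (f - e) + z = V' g - t • e := by rw [hz]; module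
    rw [this, map_sub, map_smul, hf]
    nth_rewrite 1 [← he]
    abel
  have h3 : t * ‖f - e‖ ≤ ‖z‖ := by
    have h4 := hS (t • (f - e) + z)
    have h5 : S (t • (f - e) + z) = -(f - e) := (neg_eq_iff_eq_neg.2 h2).symm
    rw [h5, inner_neg_left, inner_add_right, real_inner_smul_right, real_inner_self_eq_norm_sq]
      at h4
    have h6 : t * ‖f - e‖ ^ 2 ≤ ‖f - e‖ * ‖z‖ := by
      have := neg_le_of_abs_le (abs_real_inner_le_norm (f - e) z)
      linarith
    rcases (norm_nonneg (f - e)).eq_or_lt with h | h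
    · rw [← h, mul_zero]; positivity
    · nlinarith
  have h4 : ‖f - e‖ ≤ c * ‖f‖ := by
    refine le_of_mul_le_mul_left ?_ ht0
    linarith
  have h5 : ‖f‖ ≤ 2 * ‖e‖ := by
    have h6 : ‖f‖ ≤ ‖f - e‖ + ‖e‖ := by simpa using norm_add_le (f - e) e
    have h7 : c * ‖f‖ ≤ 1 / 2 * ‖f‖ := by gcongr
    linarith
  have hc0 : 0 ≤ c := by
    refine le_trans ?_ hc
    have : 0 ≤ αU - αL := by linarith
    positivity
  refine ⟨h4.trans (by nlinarith), ?_⟩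
  have h6 : ‖V f‖ ^ 2 ≤ 8 * N * ‖e‖ ^ 2 := by
    calc ‖V f‖ ^ 2 ≤ (N + θ) * ‖f‖ ^ 2 := by
          linarith [(abs_le.1 (abs_norm_sq_sub_le V V' hV hθ f)).2]
      _ ≤ (N + N) * (2 * ‖e‖) ^ 2 := by gcongr
      _ = _ := by ring
  have h7 := hL g
  have h8 : inner ℝ (T g) g ≤ ‖V f‖ * ‖g‖ := by rw [hTg]; exact real_inner_le_norm _ _
  rw [div_mul_eq_mul_div, le_div_iff₀ h0]
  set m := inner ℝ (T g) g
  have hm : 0 ≤ m := (by positivity : (0 : ℝ) ≤ αL * ‖g‖ ^ 2).trans h7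
  rcases hm.eq_or_lt with h | h
  · rw [← h, zero_mul]; positivity
  -- Combined with $\alpha_L\|g\|^2\le m$, this lets one factor $m$ cancel, leaving
  -- $\alpha_Lm\le\|Vf\|^2$.
  · have : m ^ 2 ≤ ‖V f‖ ^ 2 * ‖g‖ ^ 2 := by rw [← mul_pow]; gcongr
    nlinarith [sq_nonneg ‖V f‖]

end Regression

end Operators

/-! ### Duality in the RKHS, and uniqueness of feature expansions -/

section Features

variable {X : Type*} {H : Type*} [NormedAddCommGroup H] [InnerProductSpace ℝ H] [CompleteSpace H]
  [RKHS ℝ H X ℝ]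

theorem inner_kerFun_one (f : H) (x : X) : inner ℝ f (RKHS.kerFun H x (1 : ℝ)) = f x := by
  rw [RKHS.inner_kerFun]; simp

theorem kern_eq_inner (x y : X) :
    kern H x y = inner ℝ (RKHS.kerFun H x (1 : ℝ)) (RKHS.kerFun H y (1 : ℝ)) := by
  rw [kern, ← RKHS.kerFun_apply, ← inner_kerFun_one, real_inner_comm]

theorem kern_comm (x y : X) : kern H x y = kern H y x := by
  rw [kern_eq_inner, kern_eq_inner, real_inner_comm]

/-- If the dual coefficients of the interpolant have the signs of the labels, then the
interpolant is the maximum-margin classifier. -/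
theorem solutionsCoincide_of_dual {n : ℕ} {x : Fin n → X} {y : Fin n → ℝ} (g : Fin n → ℝ)
    (hg : ∀ i, ∑ j, kern H (x i) (x j) * g j = y i) (hsign : ∀ i, 0 ≤ y i * g i)
    (hy : ∀ i, y i = 1 ∨ y i = -1) : SolutionsCoincide H x y := by
  set f : H := ∑ j, g j • RKHS.kerFun H (x j) (1 : ℝ) with hf
  have hin : ∀ h : H, inner ℝ f h = ∑ j, g j * h (x j) := fun h => by
    rw [hf, sum_inner]
    refine Finset.sum_congr rfl fun j _ => ?_
    rw [real_inner_smul_left, real_inner_comm, inner_kerFun_one]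
  have hfx : ∀ i, f (x i) = y i := fun i => by
    rw [← inner_kerFun_one, hin, ← hg i]
    refine Finset.sum_congr rfl fun j _ => ?_
    rw [← inner_kerFun_one, ← kern_eq_inner, mul_comm]
  have hyy : ∀ i, y i * y i = 1 := fun i => by rcases hy i with h | h <;> rw [h] <;> norm_num
  -- Because $y_ig_i\ge0$, every feasible $h$ satisfies $\langle f,h\rangle\ge\|f\|^2$. This
  -- Pythagorean inequality yields minimality and uniqueness for both problems at once.
  have key : ∀ h : H, (∀ i, 1 ≤ y i * h (x i)) → ‖h - f‖ ^ 2 ≤ ‖h‖ ^ 2 - ‖f‖ ^ 2 := by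
    intro h hh
    have h1 : inner ℝ f f ≤ inner ℝ f h := by
      rw [hin, hin]
      refine Finset.sum_le_sum fun i _ => ?_
      rw [hfx]
      have h2 : g i * h (x i) = (y i * g i) * (y i * h (x i)) := by
        linear_combination (-(g i * h (x i))) * hyy i
      rw [h2]
      nlinarith [hsign i, hh i]
    rw [norm_sub_sq_real, real_inner_comm]
    rw [real_inner_self_eq_norm_sq] at h1
    linarith
  have huniq : ∀ h : H, (∀ i, 1 ≤ y i * h (x i)) → ‖h‖ ≤ ‖f‖ → h = f := by
    intro h hh hle
    have h1 := key h hh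
    have h2 : ‖h‖ ^ 2 ≤ ‖f‖ ^ 2 := by gcongr
    have h3 : ‖h - f‖ ^ 2 = 0 := le_antisymm (by linarith) (sq_nonneg _)
    exact sub_eq_zero.1 (norm_eq_zero.1 (pow_eq_zero_iff two_ne_zero |>.1 h3))
  have hle : ∀ h : H, (∀ i, 1 ≤ y i * h (x i)) → ‖f‖ ≤ ‖h‖ := by
    intro h hh
    have h1 := key h hh
    exact abs_le_of_sq_le_sq' (by nlinarith [sq_nonneg ‖h - f‖]) (norm_nonneg _) |>.2
  have hfeas : ∀ h : H, (∀ i, h (x i) = y i) → ∀ i, 1 ≤ y i * h (x i) := fun h hh i => by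
    rw [hh, hyy]
  refine ⟨f, fun h => ⟨fun hh => ?_, ?_⟩, fun h => ⟨fun hh => ?_, ?_⟩⟩
  · exact huniq h (hfeas h hh.1) (hh.2 f hfx)
  · rintro rfl; exact ⟨hfx, fun h hh => hle h (hfeas h hh)⟩
  · exact huniq h hh.1 (hh.2 f (hfeas f hfx))
  · rintro rfl; exact ⟨hfeas f hfx, hle⟩

section Mercer

variable [MeasurableSpace X] {μ : Measure X} {lam : ℕ → ℝ} {v : ℕ → X → ℝ}

theorem IsMercerSystem.memLp (h : IsMercerSystem H μ lam v) {ℓ : ℕ} (hℓ : 0 < lam ℓ) :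
    MemLp (v ℓ) 2 μ := by
  rw [memLp_two_iff_integrable_sq (h.measurable ℓ).aestronglyMeasurable]
  have h1 := h.orthonormal ℓ ℓ hℓ hℓ
  -- If the square were not integrable, its Bochner integral would be $0$ by convention, not $1$.
  by_contra h2
  rw [integral_undef (by simpa [sq] using h2)] at h1
  simp at h1

/-- Parseval's identity for finite combinations of the features. -/
theorem IsMercerSystem.integral_sum_sq (h : IsMercerSystem H μ lam v) (s : Finset ℕ) (b : ℕ → ℝ)
    (hb : ∀ ℓ ∈ s, b ℓ ≠ 0 → 0 < lam ℓ) :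
    Integrable (fun x => (∑ ℓ ∈ s, b ℓ * v ℓ x) ^ 2) μ ∧
      ∫ x, (∑ ℓ ∈ s, b ℓ * v ℓ x) ^ 2 ∂μ = ∑ ℓ ∈ s, b ℓ ^ 2 := by
  have hint : ∀ ℓ ∈ s, ∀ m ∈ s, Integrable (fun x => (b ℓ * v ℓ x) * (b m * v m x)) μ ∧
      ∫ x, (b ℓ * v ℓ x) * (b m * v m x) ∂μ = if ℓ = m then b ℓ ^ 2 else 0 := by
    intro ℓ hℓ m hm
    by_cases h1 : b ℓ = 0
    · simp [h1]
    by_cases h2 : b m = 0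
    · simp only [h2, zero_mul, mul_zero]
      refine ⟨integrable_zero _ _ _, ?_⟩
      rw [integral_zero]; split_ifs with h3
      · rw [h3, h2]; simp
      · rfl
    have e : (fun x => (b ℓ * v ℓ x) * (b m * v m x)) = fun x => (b ℓ * b m) * (v ℓ x * v m x) := by
      funext x; ring
    have hl := hb ℓ hℓ h1
    have hm' := hb m hm h2
    rw [e]
    refine ⟨((h.memLp hl).integrable_mul (h.memLp hm')).const_mul _, ?_⟩
    rw [integral_const_mul, h.orthonormal ℓ m hl hm']
    split_ifs with h3
    · rw [h3]; ring
    · ring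
  have e : (fun x => (∑ ℓ ∈ s, b ℓ * v ℓ x) ^ 2)
      = fun x => ∑ ℓ ∈ s, ∑ m ∈ s, (b ℓ * v ℓ x) * (b m * v m x) := by
    funext x; rw [sq, Finset.sum_mul_sum]
  rw [e]
  constructor
  · exact integrable_finsetSum _ fun ℓ hℓ => integrable_finsetSum _ fun m hm => (hint ℓ hℓ m hm).1
  · rw [integral_finsetSum _ fun ℓ hℓ => integrable_finsetSum _ fun m hm => (hint ℓ hℓ m hm).1]
    refine Finset.sum_congr rfl fun ℓ hℓ => ?_
    rw [integral_finsetSum _ fun m hm => (hint ℓ hℓ m hm).1,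
      Finset.sum_congr rfl fun m hm => (hint ℓ hℓ m hm).2]
    simp [hℓ]

/-- A square summable combination of the scaled features vanishes only if its coefficients do. -/
theorem IsMercerSystem.eq_zero_of_hasSum (h : IsMercerSystem H μ lam v) {c : ℕ → ℝ}
    (hc : Summable fun ℓ => c ℓ ^ 2) (h0 : ∀ x, HasSum (fun ℓ => c ℓ * (√(lam ℓ) * v ℓ x)) 0)
    {ℓ : ℕ} (hℓ : 0 < lam ℓ) : c ℓ = 0 := by
  set b : ℕ → ℝ := fun ℓ => c ℓ * √(lam ℓ) with hb
  have hb2 : ∀ m, b m ^ 2 = c m ^ 2 * lam m := fun m => by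
    simp only [hb]; rw [mul_pow, Real.sq_sqrt (h.nonneg m)]
  have hbl : ∀ m, b m ≠ 0 → 0 < lam m := fun m hm => by
    refine (h.nonneg m).lt_of_ne' fun h1 => hm ?_
    simp [hb, h1]
  have hS : ∀ x, Filter.Tendsto (fun M => ∑ m ∈ Finset.range M, b m * v m x) Filter.atTop
      (nhds 0) := fun x => by
    have := (h0 x).tendsto_sum_nat
    simpa only [hb, mul_assoc] using this
  set T := ∑' m, c m ^ 2 with hT
  -- The series tends to $0$ only pointwise, so Fatou's lemma replaces $L^2$ convergence:
  -- $\|S_N\|^2\le\liminf_M\|S_N-S_M\|^2$, and the right side is at most $\lambda_0$ (the largest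
  -- eigenvalue) times a tail of $\sum c_m^2$.
  have key : ∀ N, ∑ m ∈ Finset.range N, b m ^ 2
      ≤ lam 0 * (T - ∑ m ∈ Finset.range N, c m ^ 2) := by
    intro N
    have hTN : 0 ≤ T - ∑ m ∈ Finset.range N, c m ^ 2 :=
      sub_nonneg.2 (hc.sum_le_tsum _ fun _ _ => sq_nonneg _)
    have hdiff : ∀ M x, N ≤ M → (∑ m ∈ Finset.range N, b m * v m x)
        - ∑ m ∈ Finset.range M, b m * v m x = - ∑ m ∈ Finset.Ico N M, b m * v m x := by
      intro M x hNM
      rw [Finset.sum_Ico_eq_sub _ hNM]; ring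
    have hmeas : ∀ s : Finset ℕ, Measurable fun x => ∑ m ∈ s, b m * v m x := fun s =>
      Finset.measurable_fun_sum _ fun m _ => (h.measurable m).const_mul _
    obtain ⟨i1, e1⟩ := h.integral_sum_sq (Finset.range N) b fun m _ => hbl m
    have h1 : ENNReal.ofReal (∑ m ∈ Finset.range N, b m ^ 2)
        ≤ ENNReal.ofReal (lam 0 * (T - ∑ m ∈ Finset.range N, c m ^ 2)) := by
      rw [← e1, ofReal_integral_eq_lintegral_ofReal i1 (ae_of_all _ fun x => sq_nonneg _)]
      calc ∫⁻ x, ENNReal.ofReal ((∑ m ∈ Finset.range N, b m * v m x) ^ 2) ∂μ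
          = ∫⁻ x, Filter.liminf (fun M => ENNReal.ofReal (((∑ m ∈ Finset.range N, b m * v m x)
              - ∑ m ∈ Finset.range M, b m * v m x) ^ 2)) Filter.atTop ∂μ := by
            refine lintegral_congr fun x => ?_
            refine (Filter.Tendsto.liminf_eq ?_).symm
            refine ENNReal.tendsto_ofReal (Filter.Tendsto.pow ?_ 2)
            simpa using (tendsto_const_nhds (x := ∑ m ∈ Finset.range N, b m * v m x)).sub (hS x)
        _ ≤ Filter.liminf (fun M => ∫⁻ x, ENNReal.ofReal (((∑ m ∈ Finset.range N, b m * v m x)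
              - ∑ m ∈ Finset.range M, b m * v m x) ^ 2) ∂μ) Filter.atTop :=
            lintegral_liminf_le fun M => (((hmeas _).sub (hmeas _)).pow_const 2).ennreal_ofReal
        _ ≤ Filter.liminf (fun _ : ℕ => ENNReal.ofReal
              (lam 0 * (T - ∑ m ∈ Finset.range N, c m ^ 2))) Filter.atTop := by
            refine Filter.liminf_le_liminf ?_
            filter_upwards [Filter.eventually_ge_atTop N] with M hNM
            obtain ⟨i2, e2⟩ := h.integral_sum_sq (Finset.Ico N M) b fun m _ => hbl m
            simp only [hdiff M _ hNM, neg_sq]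
            rw [← ofReal_integral_eq_lintegral_ofReal i2 (ae_of_all _ fun x => sq_nonneg _), e2]
            refine ENNReal.ofReal_le_ofReal ?_
            have h2 : ∑ m ∈ Finset.range M, c m ^ 2 ≤ T := hc.sum_le_tsum _ fun _ _ => sq_nonneg _
            calc ∑ m ∈ Finset.Ico N M, b m ^ 2 ≤ ∑ m ∈ Finset.Ico N M, lam 0 * c m ^ 2 := by
                  refine Finset.sum_le_sum fun m _ => ?_
                  rw [hb2, mul_comm]
                  exact mul_le_mul_of_nonneg_right (h.antitone (Nat.zero_le m)) (sq_nonneg _)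
              _ = lam 0 * (∑ m ∈ Finset.range M, c m ^ 2 - ∑ m ∈ Finset.range N, c m ^ 2) := by
                  rw [← Finset.mul_sum, Finset.sum_Ico_eq_sub _ hNM]
              _ ≤ _ := by
                  have := h.nonneg 0
                  gcongr
        _ = _ := by simp
    exact (ENNReal.ofReal_le_ofReal_iff (mul_nonneg (h.nonneg 0) hTN)).1 h1
  have hlim : Filter.Tendsto (fun N => lam 0 * (T - ∑ m ∈ Finset.range N, c m ^ 2)) Filter.atTop
      (nhds 0) := by
    have := (hc.hasSum.tendsto_sum_nat.const_sub T).const_mul (lam 0)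
    simpa [hT] using this
  have h2 : b ℓ ^ 2 ≤ 0 := by
    refine ge_of_tendsto hlim ?_
    filter_upwards [Filter.eventually_gt_atTop ℓ] with N hN
    refine le_trans ?_ (key N)
    exact Finset.single_le_sum (f := fun m => b m ^ 2) (fun _ _ => sq_nonneg _)
      (Finset.mem_range.2 hN)
  rw [hb2] at h2
  have h3 : c ℓ ^ 2 = 0 := le_antisymm (by nlinarith [sq_nonneg (c ℓ)]) (sq_nonneg _)
  exact pow_eq_zero_iff two_ne_zero |>.1 h3

end Mercer

end Features

/-! ### Orthonormal features in the RKHS and the residual kernel -/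

section Features

variable {X : Type*} {H : Type*} [NormedAddCommGroup H] [InnerProductSpace ℝ H] [CompleteSpace H]
  [RKHS ℝ H X ℝ]

theorem denseRange_linearCombination_kerFun :
    DenseRange (Finsupp.linearCombination ℝ fun x : X => RKHS.kerFun H x (1 : ℝ)) := by
  have h1 : (LinearMap.range (Finsupp.linearCombination ℝ
      fun x : X => RKHS.kerFun H x (1 : ℝ))).topologicalClosure = ⊤ := by
    rw [Submodule.topologicalClosure_eq_top_iff, Submodule.eq_bot_iff]
    intro f hf
    refine RKHS.ext fun x => ?_
    rw [← inner_kerFun_one, real_inner_comm, RKHS.coe_zero]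
    refine hf _ ⟨Finsupp.single x 1, ?_⟩
    simp
  have h2 := congrArg (fun S : Submodule ℝ H => (S : Set H)) h1
  rw [DenseRange, dense_iff_closure_eq]
  simpa [Submodule.topologicalClosure_coe, LinearMap.coe_range] using h2

/-- A feature map with kernel `kern H` extends to an isometry on `H`. -/
theorem exists_isometry_of_inner_eq_kern {F : Type*} [NormedAddCommGroup F]
    [InnerProductSpace ℝ F] [CompleteSpace F] (φ : X → F)
    (hφ : ∀ x y, inner ℝ (φ x) (φ y) = kern H x y) :
    ∃ U : H →L[ℝ] F, (∀ x, U (RKHS.kerFun H x (1 : ℝ)) = φ x) ∧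
      ∀ f g, inner ℝ (U f) (U g) = inner ℝ f g := by
  set e := Finsupp.linearCombination ℝ fun x : X => RKHS.kerFun H x (1 : ℝ) with he
  set f := Finsupp.linearCombination ℝ φ with hf
  have hdense : DenseRange e := denseRange_linearCombination_kerFun
  -- Equal Gram matrices give equal norms of finite combinations; density of the kernel sections
  -- does the rest.
  have hnorm : ∀ c, ‖f c‖ = ‖e c‖ := by
    intro c
    rw [← sq_eq_sq₀ (norm_nonneg _) (norm_nonneg _), ← real_inner_self_eq_norm_sq,
      ← real_inner_self_eq_norm_sq, hf, he]
    simp only [Finsupp.linearCombination_apply, Finsupp.sum, sum_inner, inner_sum,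
      real_inner_smul_left, real_inner_smul_right, hφ, kern_eq_inner]
  set U := f.extendOfNorm e with hU
  have hb : ∀ c, ‖f c‖ ≤ 1 * ‖e c‖ := fun c => by rw [hnorm, one_mul]
  have hUe : ∀ c, U (e c) = f c := fun c => LinearMap.extendOfNorm_eq hdense ⟨1, hb⟩ c
  have hUn : ∀ g, ‖U g‖ = ‖g‖ := fun g => by
    refine hdense.induction_on (p := fun g => ‖U g‖ = ‖g‖) g ?_ fun c => by rw [hUe, hnorm]
    exact isClosed_eq (U.continuous.norm) continuous_norm
  refine ⟨U, fun x => ?_, fun g h => ?_⟩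
  · have := hUe (Finsupp.single x 1)
    simpa [he, hf] using this
  · exact (⟨U.toLinearMap, hUn⟩ : H →ₗᵢ[ℝ] F).inner_map_map g h

/-- The part of the kernel carried by the features of index `≥ p`. -/
noncomputable def resKern (H : Type*) [NormedAddCommGroup H] [InnerProductSpace ℝ H] [CompleteSpace H]
    [RKHS ℝ H X ℝ] (lam : ℕ → ℝ) (v : ℕ → X → ℝ) (p : ℕ) (x y : X) : ℝ :=
  kern H x y - ∑ ℓ : Fin p, lam ℓ * v ℓ x * v ℓ y

theorem residual_apply (v : ℕ → X → ℝ) (p : ℕ) {n : ℕ} (x : Fin n → X) (f : H) (i : Fin n) :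
    residual H v p x f i = inner ℝ f
      ((GH H v p)ᗮ.starProjection (RKHS.kerFun H (x i) (1 : ℝ))) := by
  rw [← Submodule.inner_starProjection_left_eq_right, inner_kerFun_one]
  rfl

theorem inner_residualGram (v : ℕ → X → ℝ) (p : ℕ) {n : ℕ} (x : Fin n → X) (w : EuclideanSpace ℝ (Fin n))
    (i : Fin n) : residualGram H v p x w i = ∑ j, inner ℝ
      ((GH H v p)ᗮ.starProjection (RKHS.kerFun H (x i) (1 : ℝ)))
      ((GH H v p)ᗮ.starProjection (RKHS.kerFun H (x j) (1 : ℝ))) * w j := by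
  have h1 : ContinuousLinearMap.adjoint (residual H v p x) w = ∑ j, w j •
      (GH H v p)ᗮ.starProjection (RKHS.kerFun H (x j) (1 : ℝ)) := by
    refine ext_inner_right ℝ fun f => ?_
    rw [ContinuousLinearMap.adjoint_inner_left, sum_inner, PiLp.inner_apply]
    refine Finset.sum_congr rfl fun j _ => ?_
    rw [residual_apply, real_inner_smul_left, real_inner_comm f]
    simp [mul_comm]
  rw [residualGram, ContinuousLinearMap.comp_apply, h1, residual_apply, sum_inner]
  refine Finset.sum_congr rfl fun j _ => ?_
  rw [real_inner_smul_left, real_inner_comm, mul_comm]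

theorem resKern_comm (lam : ℕ → ℝ) (v : ℕ → X → ℝ) (p : ℕ) (x y : X) : resKern H lam v p x y = resKern H lam v p y x := by
  rw [resKern, resKern, kern_comm]
  congr 1
  exact Finset.sum_congr rfl fun ℓ _ => by ring

section Mercer

variable [MeasurableSpace X] {μ : Measure X} {lam : ℕ → ℝ} {v : ℕ → X → ℝ}

/-- The scaled features are orthonormal in the reproducing kernel Hilbert space. -/
theorem IsMercerSystem.exists_orthonormal (h : IsMercerSystem H μ lam v) :
    ∃ e : ℕ → H, (∀ ℓ x, e ℓ x = √(lam ℓ) * v ℓ x) ∧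
      ∀ ℓ m, 0 < lam ℓ → 0 < lam m → inner ℝ (e ℓ) (e m) = if ℓ = m then 1 else 0 := by
  have hprod : ∀ x y ℓ, (√(lam ℓ) * v ℓ x) * (√(lam ℓ) * v ℓ y) = lam ℓ * v ℓ x * v ℓ y :=
    fun x y ℓ => by
      have := Real.mul_self_sqrt (h.nonneg ℓ)
      linear_combination (v ℓ x * v ℓ y) * this
  have hmem : ∀ x, Memℓp (fun ℓ => √(lam ℓ) * v ℓ x) 2 := fun x => by
    refine memℓp_gen ?_
    refine (h.hasSum x x).summable.congr fun ℓ => ?_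
    rw [← hprod, ENNReal.toReal_ofNat, Real.rpow_two, Real.norm_eq_abs, sq_abs, sq]
  set φ : X → lp (fun _ : ℕ => ℝ) 2 := fun x => ⟨_, hmem x⟩ with hφ
  obtain ⟨U, hUk, hUi⟩ := exists_isometry_of_inner_eq_kern (H := H) φ fun x y => by
    rw [lp.inner_eq_tsum, ← (h.hasSum x y).tsum_eq]
    refine tsum_congr fun ℓ => ?_
    rw [← hprod]; simp [hφ, mul_comm]
  set d : ℕ → lp (fun _ : ℕ => ℝ) 2 := fun ℓ => lp.single 2 ℓ 1 with hd
  have hdin : ∀ (w : lp (fun _ : ℕ => ℝ) 2) ℓ, inner ℝ w (d ℓ) = w ℓ := fun w ℓ => by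
    rw [hd, lp.inner_single_right]; simp
  refine ⟨fun ℓ => ContinuousLinearMap.adjoint U (d ℓ), fun ℓ x => ?_, fun ℓ m hℓ hm => ?_⟩
  · rw [← inner_kerFun_one, ContinuousLinearMap.adjoint_inner_left, hUk, real_inner_comm, hdin]
  -- `U` need not be onto, so orthonormality of the `d ℓ` does not transfer directly. The defect `w`
  -- is orthogonal to all feature vectors, hence a vanishing feature expansion, and its coordinates
  -- of positive eigenvalue are $0$.
  · set w := d ℓ - U (ContinuousLinearMap.adjoint U (d ℓ)) with hw
    have hw0 : ∀ x, inner ℝ w (φ x) = 0 := fun x => by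
      rw [hw, ← hUk, inner_sub_left, hUi, ContinuousLinearMap.adjoint_inner_left, sub_self]
    have hwm : w m = 0 := by
      refine h.eq_zero_of_hasSum (c := fun m => w m) ?_ (fun x => ?_) hm
      · have := lp.summable_inner (𝕜 := ℝ) w w
        refine this.congr fun k => ?_
        simp [sq]
      · have := lp.hasSum_inner (𝕜 := ℝ) w (φ x)
        rw [hw0] at this
        refine this.congr_fun ?_ |> id
        intro k
        simp [hφ, mul_comm]
    have h2 : U (ContinuousLinearMap.adjoint U (d ℓ)) = d ℓ - w := by rw [hw]; abel
    rw [ContinuousLinearMap.adjoint_inner_right, h2, inner_sub_left, hdin, hdin, hwm, hd]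
    simp [lp.single_apply, Pi.single_apply, eq_comm]

/-- Only finitely many features leave no residual. -/
theorem IsMercerSystem.residual_eq_zero (h : IsMercerSystem H μ lam v) {p : ℕ} (hp : lam p = 0)
    {n : ℕ} (x : Fin n → X) : residual H v p x = 0 := by
  have hz : ∀ ℓ, p ≤ ℓ → lam ℓ = 0 := fun ℓ hℓ =>
    le_antisymm (hp ▸ h.antitone hℓ) (h.nonneg ℓ)
  have hmem : ∀ y : X, RKHS.kerFun H y (1 : ℝ) ∈ GH H v p := by
    intro y
    have h1 : (⇑(RKHS.kerFun H y (1 : ℝ)) : X → ℝ) = ∑ ℓ : Fin p, (lam ℓ * v ℓ y) • v ℓ := by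
      funext z
      rw [← inner_kerFun_one, ← kern_eq_inner]
      have h2 : HasSum (fun ℓ => lam ℓ * v ℓ y * v ℓ z)
          (∑ ℓ ∈ Finset.range p, lam ℓ * v ℓ y * v ℓ z) :=
        hasSum_sum_of_ne_finset_zero fun ℓ hℓ => by
          rw [hz ℓ (by simpa using hℓ)]; simp
      rw [(h.hasSum y z).unique h2, Finset.sum_range, Finset.sum_apply]
      rfl
    show (⇑(RKHS.kerFun H y (1 : ℝ)) : X → ℝ) ∈ G v p
    rw [h1]
    exact Submodule.sum_mem _ fun ℓ _ => Submodule.smul_mem _ _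
      (Submodule.subset_span ⟨ℓ, rfl⟩)
  ext f i
  rw [residual_apply, (Submodule.starProjection_apply_eq_zero_iff _).2
    (Submodule.le_orthogonal_orthogonal _ (hmem (x i)))]
  simp

/-- The scaled features $\sqrt{\lambda_\ell}v_\ell$, $\ell<p$, are an orthonormal basis of $G$
inside $\mathcal H$, so projecting a kernel section onto $G^\perp$ removes exactly its first $p$
Mercer terms. This turns the operator hypothesis on $\mathcal R\mathcal R^*$ into one on an explicit
matrix. -/
theorem IsMercerSystem.inner_starProjection (h : IsMercerSystem H μ lam v) {p : ℕ}
    (hp : ∀ ℓ < p, 0 < lam ℓ) (x y : X) :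
    inner ℝ ((GH H v p)ᗮ.starProjection (RKHS.kerFun H x (1 : ℝ)))
      ((GH H v p)ᗮ.starProjection (RKHS.kerFun H y (1 : ℝ))) = resKern H lam v p x y := by
  obtain ⟨e, he, ho⟩ := h.exists_orthonormal
  have hsum : ∀ z, ∑ ℓ : Fin p, (√(lam ℓ) * v ℓ z) • e ℓ ∈ GH H v p := fun z => by
    refine Submodule.sum_mem _ fun ℓ _ => Submodule.smul_mem _ _ ?_
    show (⇑(e ℓ) : X → ℝ) ∈ G v p
    have : (⇑(e ℓ) : X → ℝ) = √(lam ℓ) • v ℓ := by funext t; rw [he]; rfl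
    rw [this]
    exact Submodule.smul_mem _ _ (Submodule.subset_span ⟨ℓ, rfl⟩)
  have hproj : ∀ z, (GH H v p)ᗮ.starProjection (RKHS.kerFun H z (1 : ℝ))
      = RKHS.kerFun H z (1 : ℝ) - ∑ ℓ : Fin p, (√(lam ℓ) * v ℓ z) • e ℓ := by
    intro z
    refine Submodule.eq_starProjection_of_mem_orthogonal ?_ ?_
    · rw [Submodule.mem_orthogonal]
      intro f hf
      -- Passing from $v_\ell$ to the unit vector divides by $\sqrt{\lambda_\ell}$, so positivity of
      -- the leading eigenvalues is essential here.
      obtain ⟨c, hc⟩ : ∃ c : Fin p → ℝ, f = ∑ ℓ, c ℓ • e ℓ := by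
        have hf' : (⇑f : X → ℝ) ∈ Submodule.span ℝ (Set.range fun ℓ : Fin p => v ℓ) := hf
        obtain ⟨c, hc⟩ := (Submodule.mem_span_range_iff_exists_fun ℝ).1 hf'
        refine ⟨fun ℓ => c ℓ / √(lam ℓ), RKHS.ext fun t => ?_⟩
        rw [← hc, ← inner_kerFun_one (∑ ℓ, _) t, sum_inner, Finset.sum_apply]
        refine Finset.sum_congr rfl fun ℓ _ => ?_
        rw [real_inner_smul_left, inner_kerFun_one, he]
        have := Real.sqrt_pos.2 (hp ℓ ℓ.2)
        simp only [Pi.smul_apply, smul_eq_mul]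
        field_simp
      have h1 : ∀ ℓ : Fin p, inner ℝ f (e ℓ) = c ℓ := fun ℓ => by
        rw [hc, sum_inner, Finset.sum_eq_single ℓ]
        · rw [real_inner_smul_left, ho _ _ (hp ℓ ℓ.2) (hp ℓ ℓ.2)]; simp
        · intro m _ hm
          rw [real_inner_smul_left, ho _ _ (hp m m.2) (hp ℓ ℓ.2), if_neg, mul_zero]
          exact fun h => hm (Fin.ext h)
        · simp
      rw [inner_sub_right, inner_sum, hc, sum_inner, ← Finset.sum_sub_distrib, ← hc]
      refine Finset.sum_eq_zero fun ℓ _ => ?_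
      rw [real_inner_smul_left, inner_kerFun_one, he, real_inner_smul_right, h1]
      ring
    · rw [sub_sub_cancel]
      exact Submodule.le_orthogonal_orthogonal _ (hsum z)
  rw [Submodule.inner_starProjection_left_eq_right,
    Submodule.starProjection_eq_self_iff.2 (Submodule.starProjection_apply_mem _ _), hproj,
    inner_sub_right, ← kern_eq_inner, inner_sum, resKern]
  congr 1
  refine Finset.sum_congr rfl fun ℓ _ => ?_
  rw [real_inner_smul_right, real_inner_comm, inner_kerFun_one, he]
  have := Real.mul_self_sqrt (h.nonneg ℓ)
  linear_combination (v ℓ x * v ℓ y) * this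

theorem IsMercerSystem.residualGram_apply (h : IsMercerSystem H μ lam v) {p : ℕ}
    (hp : ∀ ℓ < p, 0 < lam ℓ) {n : ℕ} (x : Fin n → X) (w : EuclideanSpace ℝ (Fin n)) (i : Fin n) :
    residualGram H v p x w i = ∑ j, resKern H lam v p (x i) (x j) * w j := by
  rw [inner_residualGram]
  simp only [h.inner_starProjection hp]

theorem IsMercerSystem.hasSum_resKern (h : IsMercerSystem H μ lam v) (p : ℕ) (x y : X) :
    HasSum (fun ℓ => if p ≤ ℓ then lam ℓ * v ℓ x * v ℓ y else 0) (resKern H lam v p x y) := by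
  have h1 : HasSum (fun ℓ => if ℓ < p then lam ℓ * v ℓ x * v ℓ y else 0)
      (∑ ℓ : Fin p, lam ℓ * v ℓ x * v ℓ y) := by
    rw [← Finset.sum_range (fun ℓ => lam ℓ * v ℓ x * v ℓ y)]
    have h2 : HasSum (fun ℓ => if ℓ < p then lam ℓ * v ℓ x * v ℓ y else 0) _ :=
      hasSum_sum_of_ne_finset_zero (s := Finset.range p) fun ℓ hℓ => if_neg (by simpa using hℓ)
    convert! h2 using 1
    exact Finset.sum_congr rfl fun ℓ hℓ => (if_pos (Finset.mem_range.1 hℓ)).symm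
  convert! (h.hasSum x y).sub h1 using 1
  funext ℓ
  by_cases hℓ : p ≤ ℓ
  · simp [hℓ, not_lt.2 hℓ]
  · simp [hℓ, not_le.1 hℓ]

theorem IsMercerSystem.measurable_kern (h : IsMercerSystem H μ lam v) :
    Measurable fun z : X × X => kern H z.1 z.2 := by
  refine measurable_of_tendsto_metrizable (f := fun N (z : X × X) =>
    ∑ ℓ ∈ Finset.range N, lam ℓ * v ℓ z.1 * v ℓ z.2) (fun N => ?_) ?_
  · exact Finset.measurable_fun_sum _ fun ℓ _ =>
      (((h.measurable ℓ).comp measurable_fst).const_mul _).mul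
        ((h.measurable ℓ).comp measurable_snd)
  · rw [tendsto_pi_nhds]
    exact fun z => (h.hasSum z.1 z.2).tendsto_sum_nat

end Mercer

end Features

/-! ### Tail bounds for combinations of the features -/

section Concentration

variable {X : Type*} [MeasurableSpace X] {μ : Measure X}
  {lam : ℕ → ℝ} {v : ℕ → X → ℝ} {σ2 : ℝ≥0}

theorem _root_.ProbabilityTheory.HasSubgaussianMGF.lintegral_exp_le {Ω : Type*}
    [MeasurableSpace Ω] {P : Measure Ω} {Y : Ω → ℝ} {c : ℝ≥0} (h : HasSubgaussianMGF Y c P)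
    (t : ℝ) : ∫⁻ ω, ENNReal.ofReal (Real.exp (t * Y ω)) ∂P
      ≤ ENNReal.ofReal (Real.exp (c * t ^ 2 / 2)) := by
  rw [← ofReal_integral_eq_lintegral_ofReal (h.integrable_exp_mul t)
    (ae_of_all _ fun x => (Real.exp_pos _).le)]
  exact ENNReal.ofReal_le_ofReal (h.mgf_le t)

theorem IndepSubGaussianFeatures.hasSubgaussianMGF_sum
    (h : IndepSubGaussianFeatures μ lam v σ2) (s : Finset ℕ) (b : ℕ → ℝ)
    (hb : ∀ ℓ, b ℓ ≠ 0 → 0 < lam ℓ) :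
    HasSubgaussianMGF (fun x => ∑ ℓ ∈ s, b ℓ * v ℓ x)
      (∑ ℓ ∈ s, Real.toNNReal (b ℓ ^ 2) * σ2) μ := by
  classical
  have h1 : iIndepFun (fun (ℓ : {ℓ : ℕ // 0 < lam ℓ}) => fun x => b ℓ * v ℓ x) μ :=
    h.indep.comp (fun ℓ => fun t : ℝ => b ℓ * t) fun ℓ => measurable_const_mul _
  have h2 := HasSubgaussianMGF.sum_of_iIndepFun h1
    (c := fun ℓ => Real.toNNReal (b ℓ ^ 2) * σ2)
    (s := (s.filter fun ℓ => 0 < lam ℓ).subtype fun ℓ => 0 < lam ℓ)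
    fun ℓ _ => by
      rw [Real.toNNReal_of_nonneg (sq_nonneg _)]
      exact (h.subGaussian ℓ ℓ.2).const_mul (b ℓ)
  have h0 : ∀ ℓ, ¬ 0 < lam ℓ → b ℓ = 0 := fun ℓ hℓ => by
    by_contra hne; exact hℓ (hb ℓ hne)
  have e1 : ∀ {M : Type} [AddCommMonoid M] (f : ℕ → M), (∀ ℓ, ¬ 0 < lam ℓ → f ℓ = 0) →
      ∑ ℓ ∈ (s.filter fun ℓ => 0 < lam ℓ).subtype (fun ℓ => 0 < lam ℓ), f ℓ = ∑ ℓ ∈ s, f ℓ := by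
    intro M _ f hf
    rw [Finset.sum_subtype_of_mem f (by simp)]
    exact Finset.sum_filter_of_ne fun ℓ _ hne => by_contra fun hℓ => hne (hf ℓ hℓ)
  rw [e1 (fun ℓ => Real.toNNReal (b ℓ ^ 2) * σ2)] at h2
  · refine h2.congr (ae_of_all _ fun x => ?_)
    exact e1 (fun ℓ => b ℓ * v ℓ x) fun ℓ hℓ => by simp [h0 ℓ hℓ]
  · intro ℓ hℓ
    simp [h0 ℓ hℓ]

/-- Infinite combinations of the features are sub-Gaussian. -/
theorem IndepSubGaussianFeatures.lintegral_exp_le_of_hasSum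
    (h : IndepSubGaussianFeatures μ lam v σ2) (hv : ∀ ℓ, Measurable (v ℓ)) {d : ℕ → ℝ}
    (hd : ∀ ℓ, d ℓ ≠ 0 → 0 < lam ℓ) {D : ℝ} (hD : ∀ s : Finset ℕ, ∑ ℓ ∈ s, d ℓ ^ 2 ≤ D ^ 2)
    {g : X → ℝ} (hg : ∀ x, HasSum (fun ℓ => d ℓ * v ℓ x) (g x)) (t : ℝ) :
    ∫⁻ x, ENNReal.ofReal (Real.exp (t * g x)) ∂μ
      ≤ ENNReal.ofReal (Real.exp (D ^ 2 * σ2 * t ^ 2 / 2)) := by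
  calc ∫⁻ x, ENNReal.ofReal (Real.exp (t * g x)) ∂μ
      = ∫⁻ x, Filter.liminf (fun N => ENNReal.ofReal (Real.exp
          (t * ∑ ℓ ∈ Finset.range N, d ℓ * v ℓ x))) Filter.atTop ∂μ := by
        refine lintegral_congr fun x => (Filter.Tendsto.liminf_eq ?_).symm
        exact ENNReal.tendsto_ofReal ((Real.continuous_exp.tendsto _).comp
          ((hg x).tendsto_sum_nat.const_mul t))
    _ ≤ Filter.liminf (fun N => ∫⁻ x, ENNReal.ofReal (Real.exp
          (t * ∑ ℓ ∈ Finset.range N, d ℓ * v ℓ x)) ∂μ) Filter.atTop :=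
        lintegral_liminf_le fun N => (Real.measurable_exp.comp
          ((Finset.measurable_fun_sum _ fun ℓ _ => (hv ℓ).const_mul _).const_mul t)).ennreal_ofReal
    _ ≤ Filter.liminf (fun _ : ℕ => ENNReal.ofReal (Real.exp (D ^ 2 * σ2 * t ^ 2 / 2)))
          Filter.atTop := by
        refine Filter.liminf_le_liminf (Filter.Eventually.of_forall fun N => ?_)
        refine ((h.hasSubgaussianMGF_sum (Finset.range N) d hd).lintegral_exp_le t).trans ?_
        refine ENNReal.ofReal_le_ofReal (Real.exp_le_exp.2 ?_)
        have : ((∑ ℓ ∈ Finset.range N, Real.toNNReal (d ℓ ^ 2) * σ2 : ℝ≥0) : ℝ)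
            = (∑ ℓ ∈ Finset.range N, d ℓ ^ 2) * σ2 := by
          rw [NNReal.coe_sum, Finset.sum_mul]
          simp only [NNReal.coe_mul, Real.coe_toNNReal _ (sq_nonneg _)]
        rw [this]
        have := hD (Finset.range N)
        gcongr
    _ = _ := by simp

/-- Chernoff's bound, phrased with the lower integral so that integrability never has to be checked.
-/
theorem measure_lt_le_of_lintegral_exp_le {Ω : Type*} [MeasurableSpace Ω] {P : Measure Ω}
    {f : Ω → ℝ} (hf : Measurable f) {C τ : ℝ}
    (h : ∫⁻ ω, ENNReal.ofReal (Real.exp (f ω)) ∂P ≤ ENNReal.ofReal C) :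
    P {ω | τ < f ω} ≤ ENNReal.ofReal (C * Real.exp (-τ)) := by
  have h1 := mul_meas_ge_le_lintegral (μ := P) (Real.measurable_exp.comp hf).ennreal_ofReal
    (ENNReal.ofReal (Real.exp τ))
  have h2 : P {ω | τ < f ω} ≤ P {ω | ENNReal.ofReal (Real.exp τ)
      ≤ ENNReal.ofReal ((Real.exp ∘ f) ω)} :=
    measure_mono fun ω hω => ENNReal.ofReal_le_ofReal (Real.exp_le_exp.2 (le_of_lt hω))
  have h3 : ENNReal.ofReal (Real.exp (-τ)) * ENNReal.ofReal (Real.exp τ) = 1 := by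
    rw [← ENNReal.ofReal_mul (Real.exp_pos _).le, ← Real.exp_add]; simp
  calc P {ω | τ < f ω} = ENNReal.ofReal (Real.exp (-τ)) *
        (ENNReal.ofReal (Real.exp τ) * P {ω | τ < f ω}) := by rw [← mul_assoc, h3, one_mul]
    _ ≤ ENNReal.ofReal (Real.exp (-τ)) * ENNReal.ofReal C := by
        gcongr
        exact le_trans (by gcongr) (h1.trans h)
    _ = _ := by rw [mul_comm, ENNReal.ofReal_mul' (Real.exp_pos _).le]

theorem IndepSubGaussianFeatures.measure_lt_abs_le [IsProbabilityMeasure μ]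
    (h : IndepSubGaussianFeatures μ lam v σ2) (hv : ∀ ℓ, Measurable (v ℓ)) {d : ℕ → ℝ}
    (hd : ∀ ℓ, d ℓ ≠ 0 → 0 < lam ℓ) {D : ℝ} (hD0 : 0 ≤ D)
    (hD : ∀ s : Finset ℕ, ∑ ℓ ∈ s, d ℓ ^ 2 ≤ D ^ 2)
    {g : X → ℝ} (hg : ∀ x, HasSum (fun ℓ => d ℓ * v ℓ x) (g x)) {s : ℝ} (hs : 0 ≤ s) :
    μ {x | s * √(σ2 + 1) * D < |g x|} ≤ ENNReal.ofReal (2 * Real.exp (-(s ^ 2 / 2))) := by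
  rcases hD0.eq_or_lt with h0 | h0
  · have hd0 : ∀ ℓ, d ℓ = 0 := fun ℓ => by
      have := hD {ℓ}
      rw [← h0, Finset.sum_singleton] at this
      exact pow_eq_zero_iff two_ne_zero |>.1 (le_antisymm (by simpa using this) (sq_nonneg _))
    have hg0 : ∀ x, g x = 0 := fun x => (hg x).unique (by simp [hd0, hasSum_zero])
    simp [← h0, hg0]
  have hgm : Measurable g := by
    refine measurable_of_tendsto_metrizable (f := fun N x => ∑ ℓ ∈ Finset.range N, d ℓ * v ℓ x)
      (fun N => Finset.measurable_fun_sum _ fun ℓ _ => (hv ℓ).const_mul _) ?_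
    exact tendsto_pi_nhds.2 fun x => (hg x).tendsto_sum_nat
  have hw : 0 < √((σ2 : ℝ) + 1) := Real.sqrt_pos.2 (by positivity)
  have hw2 : √((σ2 : ℝ) + 1) ^ 2 = σ2 + 1 := Real.sq_sqrt (by positivity)
  set w := √((σ2 : ℝ) + 1)
  -- The optimal Chernoff parameter for variance proxy $(\sigma^2+1)D^2$; the exponent is
  -- $s^2/2-s^2$. Using $\sigma^2+1$ instead of $\sigma^2$ avoids division by zero.
  set t := s / (w * D) with ht
  have htD : D ^ 2 * σ2 * t ^ 2 / 2 ≤ s ^ 2 / 2 := by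
    have : D ^ 2 * w ^ 2 * t ^ 2 = s ^ 2 := by rw [ht]; field_simp
    rw [hw2] at this
    nlinarith [mul_nonneg (sq_nonneg D) (sq_nonneg t)]
  have hexp := fun r => (h.lintegral_exp_le_of_hasSum hv hd hD hg r)
  have tail : ∀ r : ℝ, r ^ 2 = t ^ 2 → μ {x | s ^ 2 < r * g x}
      ≤ ENNReal.ofReal (Real.exp (-(s ^ 2 / 2))) := by
    intro r hr
    have h1 := hexp r
    rw [hr] at h1
    refine (measure_lt_le_of_lintegral_exp_le (hgm.const_mul r) h1).trans ?_
    rw [← Real.exp_add]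
    exact ENNReal.ofReal_le_ofReal (Real.exp_le_exp.2 (by linarith))
  rcases hs.eq_or_lt with hs0 | hs0
  · rw [← hs0]
    refine prob_le_one.trans ?_
    rw [ENNReal.one_le_ofReal]; norm_num
  have ht0 : 0 < t := by positivity
  have hts : t * (s * w * D) = s ^ 2 := by rw [ht]; field_simp
  calc μ {x | s * w * D < |g x|} ≤ μ ({x | s ^ 2 < t * g x} ∪ {x | s ^ 2 < -t * g x}) := by
        refine measure_mono fun x hx => ?_
        rw [Set.mem_ofPred_eq] at hx
        have h2 := mul_lt_mul_of_pos_left hx ht0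
        rw [hts] at h2
        rcases abs_choice (g x) with h3 | h3 <;> rw [h3] at h2
        · exact Or.inl h2
        · right; rw [Set.mem_ofPred_eq]; linarith
    _ ≤ _ := measure_union_le _ _
    _ ≤ _ := add_le_add (tail t rfl) (tail (-t) (neg_sq t))
    _ = _ := by rw [← ENNReal.ofReal_add (by positivity) (by positivity), two_mul]

theorem lintegral_exp_sq_gaussianReal_le {b : ℝ} (hb : b ≤ 1 / 4) :
    ∫⁻ z, ENNReal.ofReal (Real.exp (b * z ^ 2)) ∂(gaussianReal 0 1) ≤ ENNReal.ofReal (√2) := by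
  have h1 : ∀ z : ℝ, ENNReal.ofReal (Real.exp (b * z ^ 2))
      ≤ ENNReal.ofReal (Real.exp (1 / 4 * z ^ 2)) := fun z => by gcongr
  refine (lintegral_mono h1).trans ?_
  have hm : Measurable fun z : ℝ => ENNReal.ofReal (Real.exp (1 / 4 * z ^ 2)) := by fun_prop
  rw [gaussianReal_of_var_ne_zero 0 one_ne_zero,
    lintegral_withDensity_eq_lintegral_mul _ (measurable_gaussianPDF _ _) hm]
  have h2 : ∀ z : ℝ, (gaussianPDF 0 1 * fun z => ENNReal.ofReal (Real.exp (1 / 4 * z ^ 2))) z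
      = ENNReal.ofReal ((√(2 * Real.pi))⁻¹ * Real.exp (-(1 / 4) * z ^ 2)) := fun z => by
    rw [Pi.mul_apply, gaussianPDF, gaussianPDFReal, ← ENNReal.ofReal_mul (by positivity), mul_assoc,
      ← Real.exp_add]
    congr 3
    · simp
    · simp; ring
  simp_rw [h2]
  rw [← ofReal_integral_eq_lintegral_ofReal
    ((integrable_exp_neg_mul_sq (by norm_num)).const_mul _)
    (ae_of_all _ fun z => by positivity), integral_const_mul, integral_gaussian]
  refine ENNReal.ofReal_le_ofReal (le_of_eq ?_)
  rw [show Real.pi / (1 / 4) = 2 * (2 * Real.pi) by ring,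
    Real.sqrt_mul (x := 2) (by norm_num) (2 * Real.pi)]
  have : 0 < √(2 * Real.pi) := Real.sqrt_pos.2 (by positivity)
  rw [mul_left_comm, inv_mul_cancel₀ this.ne', mul_one]

/-- The square of a sub-Gaussian variable has an exponential moment. -/
theorem _root_.ProbabilityTheory.HasSubgaussianMGF.lintegral_exp_sq_le [SFinite μ] {Y : X → ℝ}
    (hY : Measurable Y) (h : HasSubgaussianMGF Y σ2 μ) :
    ∫⁻ x, ENNReal.ofReal (Real.exp (Y x ^ 2 / (4 * (σ2 + 1)))) ∂μ ≤ ENNReal.ofReal (√2) := by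
  -- The square is linearized by an independent standard Gaussian $z$: $e^{r^2Y^2/2}=\mathbb E_z
  -- e^{rzY}$. After exchanging the integrals, the Gaussian exponent is $\sigma^2r^2z^2/2\le z^2/4$
  -- for this $r$.
  set r : ℝ := √(1 / (2 * (σ2 + 1))) with hr
  have hr2 : r ^ 2 = 1 / (2 * (σ2 + 1)) := Real.sq_sqrt (by positivity)
  have h1 : ∀ x, ENNReal.ofReal (Real.exp (Y x ^ 2 / (4 * (σ2 + 1))))
      = ∫⁻ z, ENNReal.ofReal (Real.exp (r * z * Y x)) ∂(gaussianReal 0 1) := fun x => by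
    have h2 := mgf_gaussianReal (p := gaussianReal 0 1) (X := id) (by rw [Measure.map_id])
      (r * Y x)
    have e : ∀ z : ℝ, Real.exp (r * z * Y x) = Real.exp ((r * Y x) * z) := fun z => by ring_nf
    simp_rw [e]
    rw [← ofReal_integral_eq_lintegral_ofReal (integrable_exp_mul_gaussianReal _)
      (ae_of_all _ fun z => (Real.exp_pos _).le)]
    rw [mgf] at h2
    simp only [id_eq] at h2
    rw [h2]
    congr 2
    rw [mul_pow, hr2, NNReal.coe_one]; field_simp; ring
  simp_rw [h1]
  rw [lintegral_lintegral_swap]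
  · calc _ ≤ ∫⁻ z, ENNReal.ofReal (Real.exp ((σ2 * r ^ 2 / 2) * z ^ 2)) ∂(gaussianReal 0 1) := by
          refine lintegral_mono fun z => ?_
          refine (h.lintegral_exp_le (r * z)).trans (le_of_eq ?_)
          congr 2; ring
      _ ≤ _ := lintegral_exp_sq_gaussianReal_le (by
          rw [hr2, mul_one_div, div_div, div_le_div_iff₀ (by positivity) (by norm_num)]
          nlinarith [σ2.coe_nonneg])
  · refine Measurable.aemeasurable (Measurable.ennreal_ofReal (Real.measurable_exp.comp ?_))
    exact (measurable_snd.const_mul r).mul (hY.comp measurable_fst)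

/-- By independence the exponential moments multiply to at most $\sqrt2^{\,p}\le e^p$, and the
threshold, divided by $4(\sigma^2+1)$, is $2p$; Chernoff's bound leaves $e^{p-2p}$. -/
theorem IndepSubGaussianFeatures.measure_lt_sum_sq_le [SFinite μ]
    (h : IndepSubGaussianFeatures μ lam v σ2) (hv : ∀ ℓ, Measurable (v ℓ)) {p : ℕ}
    (hp : ∀ ℓ < p, 0 < lam ℓ) :
    μ {x | 8 * (σ2 + 1) * p < ∑ ℓ : Fin p, v ℓ x ^ 2} ≤ ENNReal.ofReal (Real.exp (-p)) := by
  have hind : iIndepFun (fun (ℓ : Fin p) => fun x =>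
      ENNReal.ofReal (Real.exp (v ℓ x ^ 2 / (4 * (σ2 + 1))))) μ := by
    have h1 : iIndepFun (fun ℓ : Fin p => v ℓ) μ :=
      h.indep.precomp (g := fun ℓ : Fin p => (⟨ℓ, hp ℓ ℓ.2⟩ : {ℓ : ℕ // 0 < lam ℓ}))
        fun a b hab => Fin.ext (congrArg (fun z => z.1) hab)
    exact h1.comp (fun _ => fun t => ENNReal.ofReal (Real.exp (t ^ 2 / (4 * (σ2 + 1)))))
      fun _ => (Real.measurable_exp.comp ((measurable_id.pow_const 2).div_const _)).ennreal_ofReal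
  have hm : ∀ ℓ : Fin p, Measurable fun x => v ℓ x ^ 2 / (4 * ((σ2 : ℝ) + 1)) := fun ℓ =>
    ((hv ℓ).pow_const 2).div_const _
  have h1 : ∫⁻ x, ENNReal.ofReal (Real.exp (∑ ℓ : Fin p, v ℓ x ^ 2 / (4 * (σ2 + 1)))) ∂μ
      ≤ ENNReal.ofReal (√2 ^ p) := by
    calc _ = ∫⁻ x, ∏ ℓ : Fin p, ENNReal.ofReal (Real.exp (v ℓ x ^ 2 / (4 * (σ2 + 1)))) ∂μ := by
          refine lintegral_congr fun x => ?_
          rw [Real.exp_sum, ENNReal.ofReal_prod_of_nonneg fun _ _ => (Real.exp_pos _).le]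
      _ = ∏ ℓ : Fin p, ∫⁻ x, ENNReal.ofReal (Real.exp (v ℓ x ^ 2 / (4 * (σ2 + 1)))) ∂μ :=
          lintegral_prod_eq_prod_lintegral_of_indepFun _ _ hind fun ℓ =>
            (Real.measurable_exp.comp (hm ℓ)).ennreal_ofReal
      _ ≤ ∏ _ℓ : Fin p, ENNReal.ofReal (√2) := by
          gcongr with ℓ
          exact (h.subGaussian ℓ (hp ℓ ℓ.2)).lintegral_exp_sq_le (hv ℓ)
      _ = _ := by
          rw [Finset.prod_const, Finset.card_univ, Fintype.card_fin,
            ENNReal.ofReal_pow (Real.sqrt_nonneg _)]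
  have h2 : {x | 8 * ((σ2 : ℝ) + 1) * p < ∑ ℓ : Fin p, v ℓ x ^ 2}
      ⊆ {x | 2 * (p : ℝ) < ∑ ℓ : Fin p, v ℓ x ^ 2 / (4 * (σ2 + 1))} := by
    intro x hx
    rw [Set.mem_ofPred_eq] at hx ⊢
    rw [← Finset.sum_div, lt_div_iff₀ (by positivity)]
    linarith
  refine (measure_mono h2).trans ((measure_lt_le_of_lintegral_exp_le
    (Finset.measurable_fun_sum _ fun ℓ _ => hm ℓ) h1).trans (ENNReal.ofReal_le_ofReal ?_))
  have h3 : √2 ≤ Real.exp 1 := by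
    have h4 := Real.add_one_le_exp (1 : ℝ)
    have : √2 ≤ 2 := by rw [Real.sqrt_le_left (by norm_num)]; norm_num
    linarith
  calc √2 ^ p * Real.exp (-(2 * p)) ≤ Real.exp 1 ^ p * Real.exp (-(2 * p)) := by gcongr
    _ = _ := by rw [← Real.exp_nat_mul, ← Real.exp_add]; congr 1; ring

end Concentration

/-! ### Leaving one point out, and the label noise -/

section Sample

variable {X Ω : Type*} [MeasurableSpace X] [MeasurableSpace Ω] {P : Measure Ω}
  {μ : Measure X} {n : ℕ}

/-- A bound uniform over the other points holds for the left-out point. -/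
theorem measure_leaveOneOut_le [IsProbabilityMeasure P] {x : Fin n → Ω → X} (hx : ∀ i, Measurable (x i))
    (hind : iIndepFun x P) (i : Fin n) {B : Set (({j : Fin n // j ≠ i} → X) × X)}
    (hB : MeasurableSet B) {c : ℝ≥0∞} (h : ∀ u, P.map (x i) {z | (u, z) ∈ B} ≤ c) :
    P {ω | ((fun j : {j : Fin n // j ≠ i} => x j ω), x i ω) ∈ B} ≤ c := by
  have h1 : IndepFun (fun ω (j : {j : Fin n // j ≠ i}) => x j ω) (x i) P := by
    have h2 := hind.indepFun_finset (Finset.univ.erase i) {i} (by simp) hx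
    refine h2.comp (φ := fun (f : ↥(Finset.univ.erase i) → X)
      (j : {j : Fin n // j ≠ i}) => f ⟨j, by simpa using j.2⟩)
      (ψ := fun (f : ↥({i} : Finset (Fin n)) → X) => f ⟨i, by simp⟩) ?_ (measurable_pi_apply _)
    exact measurable_pi_lambda _ fun j => measurable_pi_apply _
  have hm : Measurable fun ω (j : {j : Fin n // j ≠ i}) => x j ω :=
    measurable_pi_lambda _ fun j => hx j
  have h3 := (indepFun_iff_map_prod_eq_prod_map_map hm.aemeasurable (hx i).aemeasurable).1 h1
  have h4 : P {ω | ((fun j : {j : Fin n // j ≠ i} => x j ω), x i ω) ∈ B}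
      = P.map (fun ω => ((fun j : {j : Fin n // j ≠ i} => x j ω), x i ω)) B :=
    (Measure.map_apply (hm.prodMk (hx i)) hB).symm
  have := Measure.isProbabilityMeasure_map (μ := P) hm.aemeasurable
  have := Measure.isProbabilityMeasure_map (μ := P) (hx i).aemeasurable
  -- The left-out point is independent of the others, so their joint law is a product and Fubini
  -- applies.
  rw [h4, h3, Measure.prod_apply hB]
  calc _ ≤ ∫⁻ _, c ∂(P.map fun ω (j : {j : Fin n // j ≠ i}) => x j ω) := lintegral_mono h
    _ = c := by simp

variable {η : X → ℝ} {x : Fin n → Ω → X} {y : Fin n → Ω → ℝ}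

theorem IsSample.iIndepFun_x (h : IsSample P μ η x y) : iIndepFun x P :=
  h.indep.comp (fun _ => Prod.fst) fun _ => measurable_fst

/-- A conditional expectation of signs lies in $[-1,1]$; this makes $(1\pm\eta)/2$ genuine
conditional probabilities at the sample points. -/
theorem IsSample.ae_abs_le (h : IsSample P μ η x y) (i : Fin n) :
    ∀ᵐ ω ∂P, |η (x i ω)| ≤ 1 := by
  have h1 : ∀ᵐ ω ∂P, |y i ω| ≤ 1 := by
    filter_upwards [h.label i] with ω hω
    rcases hω with hω | hω <;> simp [hω]
  filter_upwards [ae_bdd_abs_condExp_of_ae_bdd_abs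
    (m := MeasurableSpace.comap (x i) inferInstance) h1, h.regression i] with ω h2 h3
  rwa [h3] at h2

/-- The conditional law of the label. -/
theorem IsSample.measure_inter [IsProbabilityMeasure P] (h : IsSample P μ η x y) (hη : Measurable η) (i : Fin n) {s : ℝ}
    (hs : s = 1 ∨ s = -1) {B : Set X} (hB : MeasurableSet B) :
    P (x i ⁻¹' B ∩ {ω | y i ω = s}) =
      ∫⁻ ω, B.indicator (fun z => ENNReal.ofReal ((1 + s * η z) / 2)) (x i ω) ∂P := by
  have hA : MeasurableSet (x i ⁻¹' B) := h.measurable_x i hB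
  have hyb : ∀ᵐ ω ∂P, ‖y i ω‖ ≤ 1 := by
    filter_upwards [h.label i] with ω hω
    rcases hω with hω | hω <;> simp [hω]
  have hyi : Integrable (y i) P :=
    Integrable.of_bound (h.measurable_y i).aestronglyMeasurable 1 hyb
  have hηi : Integrable (fun ω => η (x i ω)) P :=
    Integrable.of_bound (hη.comp (h.measurable_x i)).aestronglyMeasurable 1 (h.ae_abs_le i)
  have hs1 : |s| = 1 := by rcases hs with rfl | rfl <;> simp
  have hreg : ∫ ω in x i ⁻¹' B, y i ω ∂P = ∫ ω in x i ⁻¹' B, η (x i ω) ∂P := by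
    rw [← setIntegral_condExp (m := MeasurableSpace.comap (x i) inferInstance)
      (h.measurable_x i).comap_le hyi ⟨B, hB, rfl⟩]
    exact setIntegral_congr_ae hA ((h.regression i).mono fun ω hω _ => hω)
  have hnn : ∀ {f : Ω → ℝ}, (∀ᵐ ω ∂P, |f ω| ≤ 1) →
      0 ≤ᵐ[P.restrict (x i ⁻¹' B)] fun ω => (1 + s * f ω) / 2 := fun {f} hf => by
    filter_upwards [ae_restrict_of_ae hf] with ω hω
    have : |s * f ω| ≤ 1 := by rw [abs_mul, hs1, one_mul]; exact hω
    have := (abs_le.1 this).1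
    show 0 ≤ (1 + s * f ω) / 2
    linarith
  have hint : ∀ {f : Ω → ℝ}, Integrable f P →
      Integrable (fun ω => (1 + s * f ω) / 2) (P.restrict (x i ⁻¹' B)) := fun hf =>
    (((integrable_const 1).add (hf.const_mul s)).div_const 2).restrict
  have hval : ∀ {f : Ω → ℝ}, Integrable f P → ∫ ω in x i ⁻¹' B, (1 + s * f ω) / 2 ∂P
      = (P.real (x i ⁻¹' B) + s * ∫ ω in x i ⁻¹' B, f ω ∂P) / 2 := fun hf => by
    rw [integral_div, integral_add (integrable_const _) (hf.const_mul s).restrict,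
      integral_const_mul]
    simp
  have hind : ∫⁻ ω, B.indicator (fun z => ENNReal.ofReal ((1 + s * η z) / 2)) (x i ω) ∂P
      = ∫⁻ ω in x i ⁻¹' B, ENNReal.ofReal ((1 + s * η (x i ω)) / 2) ∂P := by
    rw [← lintegral_indicator hA]; rfl
  -- For signs, $1_{\{y=s\}}=(1+sy)/2$, which is affine in $y$; so $\eta(x)$ may be exchanged for
  -- $y$ over any event determined by $x$.
  rw [hind, ← ofReal_integral_eq_lintegral_ofReal (hint hηi) (hnn (h.ae_abs_le i)), hval hηi,
    ← hreg, ← hval hyi, ofReal_integral_eq_lintegral_ofReal (hint hyi) (hnn hyb)]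
  have hS : MeasurableSet {ω | y i ω = s} := h.measurable_y i (measurableSet_singleton s)
  rw [Set.inter_comm, ← Measure.restrict_apply hS, ← lintegral_indicator_one hS]
  refine lintegral_congr_ae ?_
  filter_upwards [ae_restrict_of_ae (h.label i)] with ω hω
  simp only [Set.indicator_apply, Set.mem_ofPred_eq, Pi.one_apply]
  rcases hω with hω | hω <;> rcases hs with rfl | rfl <;> rw [hω] <;> norm_num

/-- The joint law of the points on the event that the labels form the sign vector `s`. -/
theorem IsSample.setLIntegral_labels [IsProbabilityMeasure P] (h : IsSample P μ η x y) (hη : Measurable η) {s : Fin n → ℝ}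
    (hs : ∀ i, s i = 1 ∨ s i = -1) {f : (Fin n → X) → ℝ≥0∞} (hf : Measurable f) :
    ∫⁻ ω in {ω | ∀ i, y i ω = s i}, f (fun i => x i ω) ∂P =
      ∫⁻ ω, f (fun i => x i ω) * ∏ i, ENNReal.ofReal ((1 + s i * η (x i ω)) / 2) ∂P := by
  have hxm : Measurable fun ω i => x i ω := measurable_pi_lambda _ h.measurable_x
  have hwm : ∀ i, Measurable fun z => ENNReal.ofReal ((1 + s i * η z) / 2) := fun i =>
    (((hη.const_mul _).const_add _).div_const _).ennreal_ofReal
  have hWm : Measurable fun u : Fin n → X => ∏ i, ENNReal.ofReal ((1 + s i * η (u i)) / 2) :=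
    Finset.measurable_fun_prod _ fun i _ => (hwm i).comp (measurable_pi_apply i)
  -- The product of these measures agrees on boxes both with the restricted joint law and with the
  -- law weighted by $\prod_i(1+s_i\eta)/2$, so those two coincide.
  set ν : Fin n → Measure X := fun i => (P.restrict {ω | y i ω = s i}).map (x i) with hν
  have hνB : ∀ i B, MeasurableSet B → ν i B = P (x i ⁻¹' B ∩ {ω | y i ω = s i}) :=
    fun i B hB => by
      rw [hν, Measure.map_apply (h.measurable_x i) hB,
        Measure.restrict_apply (h.measurable_x i hB)]
  have h1 : Measure.pi ν = (P.restrict {ω | ∀ i, y i ω = s i}).map fun ω i => x i ω := by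
    refine Measure.pi_eq fun B hB => ?_
    rw [Measure.map_apply hxm (MeasurableSet.univ_pi hB),
      Measure.restrict_apply (hxm (MeasurableSet.univ_pi hB))]
    have h2 := h.indep.measure_inter_preimage_eq_mul Finset.univ
      (sets := fun i => B i ×ˢ {s i}) fun i _ => (hB i).prod (measurableSet_singleton _)
    have h3 : (fun ω i => x i ω) ⁻¹' Set.univ.pi B ∩ {ω | ∀ i, y i ω = s i}
        = ⋂ i ∈ Finset.univ, (fun ω => (x i ω, y i ω)) ⁻¹' (B i ×ˢ {s i}) := by
      ext ω
      simp [forall_and]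
    rw [h3, h2]
    refine Finset.prod_congr rfl fun i _ => ?_
    rw [hνB i _ (hB i)]
    congr 1
  have h4 : Measure.pi ν = (P.map fun ω i => x i ω).withDensity
      fun u => ∏ i, ENNReal.ofReal ((1 + s i * η (u i)) / 2) := by
    refine Measure.pi_eq fun B hB => ?_
    have hBm := MeasurableSet.univ_pi hB
    rw [withDensity_apply _ hBm, ← lintegral_indicator hBm,
      lintegral_map (hWm.indicator hBm) hxm]
    have hind : iIndepFun (fun i ω =>
        (B i).indicator (fun z => ENNReal.ofReal ((1 + s i * η z) / 2)) (x i ω)) P :=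
      h.iIndepFun_x.comp (fun i => (B i).indicator fun z => ENNReal.ofReal ((1 + s i * η z) / 2))
        fun i => (hwm i).indicator (hB i)
    have h5 := lintegral_prod_eq_prod_lintegral_of_indepFun Finset.univ _ hind fun i =>
      ((hwm i).indicator (hB i)).comp (h.measurable_x i)
    have h6 : ∀ ω, (Set.univ.pi B).indicator
        (fun u : Fin n → X => ∏ i, ENNReal.ofReal ((1 + s i * η (u i)) / 2)) (fun i => x i ω)
        = ∏ i, (B i).indicator (fun z => ENNReal.ofReal ((1 + s i * η z) / 2)) (x i ω) := by
      intro ω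
      by_cases hω : ∀ i, x i ω ∈ B i
      · rw [Set.indicator_of_mem (by simpa using hω)]
        exact Finset.prod_congr rfl fun i _ => by
          rw [Set.indicator_of_mem (hω i)]
      · rw [Set.indicator_of_notMem (by simpa using hω)]
        obtain ⟨i, hi⟩ := not_forall.1 hω
        exact (Finset.prod_eq_zero (Finset.mem_univ i) (Set.indicator_of_notMem hi _)).symm
    simp_rw [h6]
    rw [h5]
    refine Finset.prod_congr rfl fun i _ => ?_
    rw [hνB i _ (hB i), h.measure_inter hη i (hs i) (hB i)]
  rw [← lintegral_map hf hxm, ← h1, h4, lintegral_withDensity_eq_lintegral_mul _ hWm hf,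
    lintegral_map (hWm.mul hf) hxm]
  exact lintegral_congr fun ω => by rw [Pi.mul_apply, mul_comm]

/-- Hoeffding's lemma for the law on $\{-1,1\}$ with mean $m$: an interval of length $2$ has
variance proxy $1$. -/
theorem two_point_exp_le {m : ℝ} (hm : |m| ≤ 1) (q : ℝ) :
    (1 + m) / 2 * Real.exp (q * (1 - m)) + (1 - m) / 2 * Real.exp (q * (-1 - m))
      ≤ Real.exp (q ^ 2 / 2) := by
  obtain ⟨h1, h2⟩ := abs_le.1 hm
  set ρ : Measure ℝ := ENNReal.ofReal ((1 + m) / 2) • Measure.dirac 1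
    + ENNReal.ofReal ((1 - m) / 2) • Measure.dirac (-1) with hρ
  have hprob : IsProbabilityMeasure ρ := ⟨by
    rw [hρ, Measure.add_apply, Measure.smul_apply, Measure.smul_apply, measure_univ, measure_univ,
      smul_eq_mul, smul_eq_mul, mul_one, mul_one,
      ← ENNReal.ofReal_add (by linarith) (by linarith)]
    rw [← add_div, add_add_sub_cancel]; norm_num⟩
  have hint : ∀ f : ℝ → ℝ, ∫ z, f z ∂ρ = (1 + m) / 2 * f 1 + (1 - m) / 2 * f (-1) := fun f => by
    have hi : ∀ (z w : ℝ), Integrable f (ENNReal.ofReal w • Measure.dirac z) := fun z w =>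
      (integrable_dirac (by simp)).smul_measure ENNReal.ofReal_ne_top
    rw [hρ, integral_add_measure (hi _ _) (hi _ _), integral_smul_measure, integral_smul_measure,
      integral_dirac, integral_dirac, ENNReal.toReal_ofReal (by linarith),
      ENNReal.toReal_ofReal (by linarith)]
    rfl
  have hmean : ∫ z, z ∂ρ = m := by rw [hint]; ring
  have hmem : ∀ᵐ z ∂ρ, (id z : ℝ) ∈ Set.Icc (-1 : ℝ) 1 := by
    rw [hρ, ae_add_measure_iff]
    constructor <;>
    · refine Measure.ae_smul_measure ?_ _
      rw [ae_dirac_iff (measurableSet_Icc.preimage measurable_id)]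
      norm_num
  have h3 := (hasSubgaussianMGF_of_mem_Icc aemeasurable_id hmem).mgf_le q
  simp only [id_eq, hmean, mgf] at h3
  rw [hint] at h3
  refine h3.trans (le_of_eq ?_)
  congr 2
  norm_num

/-- Summing over the finitely many sign vectors replaces conditioning on the points: at fixed points
the sum factorizes, and each factor is at most $1$ by `two_point_exp_le`, the term $-q_i^2/2$ being
the compensator. The weights may depend on all points. -/
theorem IsSample.lintegral_exp_noise_le [IsProbabilityMeasure P] (h : IsSample P μ η x y) (hη : Measurable η)
    {q : (Fin n → X) → Fin n → ℝ} (hq : Measurable q) :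
    ∫⁻ ω, ENNReal.ofReal (Real.exp (∑ i, (q (fun i => x i ω) i * (y i ω - η (x i ω))
      - q (fun i => x i ω) i ^ 2 / 2))) ∂P ≤ 1 := by
  classical
  set F : (Fin n → ℝ) → (Fin n → X) → ℝ≥0∞ := fun s u =>
    ENNReal.ofReal (Real.exp (∑ i, (q u i * (s i - η (u i)) - q u i ^ 2 / 2))) with hF
  have hFm : ∀ s, Measurable (F s) := fun s => by
    have h1 : ∀ i, Measurable fun u => q u i := fun i => (measurable_pi_apply i).comp hq
    have h2 : ∀ i, Measurable fun u : Fin n → X => η (u i) :=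
      fun i => hη.comp (measurable_pi_apply i)
    refine (Real.measurable_exp.comp (Finset.measurable_fun_sum _ fun i _ => ?_)).ennreal_ofReal
    exact ((h1 i).mul ((h2 i).const_sub _)).sub (((h1 i).pow_const 2).div_const 2)
  have hxm : Measurable fun ω i => x i ω := measurable_pi_lambda _ h.measurable_x
  set T : Finset (Fin n → ℝ) := Fintype.piFinset fun _ => ({1, -1} : Finset ℝ) with hT
  have hTs : ∀ s ∈ T, ∀ i, s i = 1 ∨ s i = -1 := fun s hs i => by
    simpa using Fintype.mem_piFinset.1 hs i
  have hset : ∀ s : Fin n → ℝ, MeasurableSet {ω | ∀ i, y i ω = s i} := fun s => by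
    rw [Set.ofPred_forall]
    exact MeasurableSet.iInter fun i => h.measurable_y i (measurableSet_singleton _)
  have hpt : ∀ᵐ ω ∂P, ∑ s ∈ T, F s (fun i => x i ω)
      * ∏ i, ENNReal.ofReal ((1 + s i * η (x i ω)) / 2) ≤ 1 := by
    filter_upwards [ae_all_iff.2 h.ae_abs_le] with ω hω
    set g : Fin n → ℝ → ℝ≥0∞ := fun i t => ENNReal.ofReal (Real.exp (q (fun i => x i ω) i
      * (t - η (x i ω)) - q (fun i => x i ω) i ^ 2 / 2) * ((1 + t * η (x i ω)) / 2)) with hg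
    have h1 : ∀ s, F s (fun i => x i ω) * ∏ i, ENNReal.ofReal ((1 + s i * η (x i ω)) / 2)
        = ∏ i, g i (s i) := fun s => by
      rw [hF, hg]
      simp only
      rw [Real.exp_sum, ENNReal.ofReal_prod_of_nonneg fun _ _ => (Real.exp_pos _).le,
        ← Finset.prod_mul_distrib]
      exact Finset.prod_congr rfl fun i _ => (ENNReal.ofReal_mul (Real.exp_pos _).le).symm
    simp_rw [h1]
    rw [hT, ← Finset.prod_univ_sum]
    refine Finset.prod_le_one' fun i _ => ?_
    rw [Finset.sum_pair (by norm_num), hg]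
    obtain ⟨h2, h3⟩ := abs_le.1 (hω i)
    simp only
    rw [← ENNReal.ofReal_add (mul_nonneg (Real.exp_pos _).le (by linarith))
      (mul_nonneg (Real.exp_pos _).le (by linarith)), ENNReal.ofReal_le_one]
    have h4 := two_point_exp_le (hω i) (q (fun i => x i ω) i)
    set r := q (fun i => x i ω) i
    rw [sub_eq_add_neg, Real.exp_add, sub_eq_add_neg (r * _), Real.exp_add]
    have h5 : Real.exp (r ^ 2 / 2) * Real.exp (-(r ^ 2 / 2)) = 1 := by
      rw [← Real.exp_add]; simp
    nlinarith [Real.exp_pos (-(r ^ 2 / 2))]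
  have hle : ∀ᵐ ω ∂P, ENNReal.ofReal (Real.exp (∑ i, (q (fun i => x i ω) i * (y i ω - η (x i ω))
      - q (fun i => x i ω) i ^ 2 / 2)))
      ≤ ∑ s ∈ T, {ω | ∀ i, y i ω = s i}.indicator (fun ω => F s fun i => x i ω) ω := by
    filter_upwards [ae_all_iff.2 h.label] with ω hω
    have hmem : (fun i => y i ω) ∈ T := Fintype.mem_piFinset.2 fun i => by simpa using hω i
    refine le_trans (le_of_eq ?_) (Finset.single_le_sum
      (f := fun s => {ω | ∀ i, y i ω = s i}.indicator (fun ω => F s fun i => x i ω) ω)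
      (fun _ _ => zero_le) hmem)
    rw [Set.indicator_of_mem (show ω ∈ {ω' | ∀ i, y i ω' = y i ω} from fun _ => rfl)]
  refine (lintegral_mono_ae hle).trans ?_
  have hm : ∀ s ∈ T, Measurable ({ω | ∀ i, y i ω = s i}.indicator fun ω => F s fun i => x i ω) :=
    fun s _ => ((hFm s).comp hxm).indicator (hset s)
  rw [lintegral_finsetSum _ hm]
  have h6 : ∀ s ∈ T, ∫⁻ ω, {ω | ∀ i, y i ω = s i}.indicator (fun ω => F s fun i => x i ω) ω ∂P
      = ∫⁻ ω, F s (fun i => x i ω) * ∏ i, ENNReal.ofReal ((1 + s i * η (x i ω)) / 2) ∂P :=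
    fun s hs => by
      rw [lintegral_indicator (hset s), h.setLIntegral_labels hη (hTs s hs) (hFm s)]
  rw [Finset.sum_congr rfl h6, ← lintegral_finsetSum]
  · exact (lintegral_mono_ae hpt).trans (by simp)
  · intro s _
    refine ((hFm s).comp hxm).mul (Finset.measurable_fun_prod _ fun i _ => ?_)
    exact ((((hη.comp (h.measurable_x i)).const_mul _).const_add _).div_const _).ennreal_ofReal

/-- Hoeffding's inequality for the label noise, with weights depending on the points. -/
theorem IsSample.measure_lt_abs_noise_le [IsProbabilityMeasure P] (h : IsSample P μ η x y) (hη : Measurable η)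
    {q : (Fin n → X) → Fin n → ℝ} (hq : Measurable q) {s : ℝ} (hs : 0 ≤ s) :
    P {ω | s * √(∑ i, q (fun i => x i ω) i ^ 2)
      < |∑ i, q (fun i => x i ω) i * (y i ω - η (x i ω))|}
      ≤ ENNReal.ofReal (2 * Real.exp (-(s ^ 2 / 2))) := by
  rcases hs.eq_or_lt with hs0 | hs0
  · rw [← hs0]
    refine prob_le_one.trans ?_
    rw [ENNReal.one_le_ofReal]; norm_num
  have hqi : ∀ i, Measurable fun u => q u i := fun i => (measurable_pi_apply i).comp hq
  -- Dividing the weights by their random norm is legitimate because the norm depends on the points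
  -- only; the exponential bound is then used with $\pm s\,q/N$.
  set N : (Fin n → X) → ℝ := fun u => √(∑ i, q u i ^ 2) with hN
  have hNm : Measurable N :=
    (Finset.measurable_fun_sum _ fun i _ => (hqi i).pow_const 2).sqrt
  have hxm : Measurable fun ω i => x i ω := measurable_pi_lambda _ h.measurable_x
  have hNsq : ∀ u, N u ^ 2 = ∑ i, q u i ^ 2 := fun u =>
    Real.sq_sqrt (Finset.sum_nonneg fun _ _ => sq_nonneg _)
  have tail : ∀ r : ℝ, r ^ 2 = s ^ 2 → P {ω | s ^ 2 / 2 < ∑ i,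
      (r / N (fun i => x i ω) * q (fun i => x i ω) i * (y i ω - η (x i ω))
        - (r / N (fun i => x i ω) * q (fun i => x i ω) i) ^ 2 / 2)}
      ≤ ENNReal.ofReal (Real.exp (-(s ^ 2 / 2))) := by
    intro r _
    have hq' : Measurable fun u i => r / N u * q u i :=
      measurable_pi_lambda _ fun i => (hNm.const_div r).mul (hqi i)
    have h1 := h.lintegral_exp_noise_le hη hq'
    rw [← ENNReal.ofReal_one] at h1
    refine (measure_lt_le_of_lintegral_exp_le ?_ h1).trans (by rw [one_mul])
    have h2 : ∀ i, Measurable fun ω => r / N (fun i => x i ω) * q (fun i => x i ω) i := fun i =>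
      ((hNm.comp hxm).const_div r).mul ((hqi i).comp hxm)
    exact Finset.measurable_fun_sum _ fun i _ => ((h2 i).mul
      ((h.measurable_y i).sub (hη.comp (h.measurable_x i)))).sub (((h2 i).pow_const 2).div_const 2)
  refine (measure_mono ?_).trans ((measure_union_le _ _).trans
    ((add_le_add (tail s rfl) (tail (-s) (neg_sq s))).trans (le_of_eq ?_)))
  · intro ω hω
    rw [Set.mem_ofPred_eq] at hω
    change s * N (fun i => x i ω) < _ at hω
    have hN0 : 0 < N fun i => x i ω := by
      refine (Real.sqrt_nonneg _).lt_of_ne' fun h0 => ?_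
      have hz : ∀ i, q (fun i => x i ω) i = 0 := fun i => by
        have h1 := hNsq fun i => x i ω
        rw [hN] at h1
        simp only at h1
        rw [h0, zero_pow two_ne_zero, eq_comm,
          Finset.sum_eq_zero_iff_of_nonneg fun _ _ => sq_nonneg _] at h1
        exact pow_eq_zero_iff two_ne_zero |>.1 (h1 i (Finset.mem_univ i))
      simp [hz, hN] at hω
    have hexp : ∀ r : ℝ, r ^ 2 = s ^ 2 → ∑ i,
        (r / N (fun i => x i ω) * q (fun i => x i ω) i * (y i ω - η (x i ω))
          - (r / N (fun i => x i ω) * q (fun i => x i ω) i) ^ 2 / 2)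
        = r / N (fun i => x i ω) * (∑ i, q (fun i => x i ω) i * (y i ω - η (x i ω)))
          - s ^ 2 / 2 := fun r hr => by
      rw [Finset.sum_sub_distrib, Finset.mul_sum, ← Finset.sum_div]
      simp_rw [mul_pow]
      rw [← Finset.mul_sum, ← hNsq, div_pow, hr, div_mul_cancel₀ _ (by positivity)]
      congr 1
      exact Finset.sum_congr rfl fun i _ => by ring
    have h2 : s ^ 2 < s / N (fun i => x i ω)
        * |∑ i, q (fun i => x i ω) i * (y i ω - η (x i ω))| := by
      rw [div_mul_eq_mul_div, lt_div_iff₀ hN0]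
      nlinarith
    rcases abs_choice (∑ i, q (fun i => x i ω) i * (y i ω - η (x i ω))) with h3 | h3 <;>
      rw [h3] at h2
    · left
      rw [Set.mem_ofPred_eq, hexp s rfl]
      linarith
    · right
      rw [Set.mem_ofPred_eq, hexp (-s) (neg_sq s), neg_div, neg_mul]
      linarith
  · rw [← ENNReal.ofReal_add (by positivity) (by positivity), two_mul]

end Sample

/-! ### Matrices as operators, kernel matrices and interpolation weights -/

theorem inner_toLpLin {m n : Type*} [Fintype m] [Fintype n] [DecidableEq m] [DecidableEq n]
    (B : Matrix m n ℝ) (u : EuclideanSpace ℝ n) (w : EuclideanSpace ℝ m) :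
    inner ℝ (Matrix.toLpLin 2 2 B u) w = inner ℝ u (Matrix.toLpLin 2 2 B.transpose w) := by
  simp only [EuclideanSpace.inner_eq_star_dotProduct, Matrix.toLpLin_apply, star_trivial]
  rw [Matrix.mulVec_transpose, Matrix.dotProduct_mulVec]

theorem isSymmetric_toLpLin {n : Type*} [Fintype n] [DecidableEq n]
    {B : Matrix n n ℝ} (hB : B.IsSymm) :
    (Matrix.toLpLin 2 2 B : EuclideanSpace ℝ n →ₗ[ℝ] EuclideanSpace ℝ n).IsSymmetric :=
  fun u w => by rw [inner_toLpLin, hB.eq]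

theorem inner_toLpLin_self {n : Type*} [Fintype n] [DecidableEq n]
    (B : Matrix n n ℝ) (w : EuclideanSpace ℝ n) :
    inner ℝ (Matrix.toLpLin 2 2 B w) w = ∑ i, ∑ j, B i j * w j * w i := by
  rw [PiLp.inner_apply]
  refine Finset.sum_congr rfl fun i _ => ?_
  simp only [Matrix.toLpLin_apply, Matrix.mulVec, dotProduct, RCLike.inner_apply, conj_trivial]
  rw [mul_comm, Finset.sum_mul]

/-- By Cramer's rule the entries are rational in those of `A t`. Invertibility is not required,
since the inverse matrix is $0$ when the determinant vanishes. -/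
theorem measurable_inv_mulVec {α J : Type*} [MeasurableSpace α] [Fintype J] [DecidableEq J]
    {A : α → Matrix J J ℝ} (hA : ∀ j k, Measurable fun t => A t j k) {b : α → J → ℝ}
    (hb : ∀ j, Measurable fun t => b t j) (j : J) :
    Measurable fun t => ((A t)⁻¹.mulVec (b t)) j := by
  have hdet : ∀ {B : α → Matrix J J ℝ}, (∀ j k, Measurable fun t => B t j k) →
      Measurable fun t => (B t).det := fun {B} hB => by
    simp_rw [Matrix.det_apply]
    exact Finset.measurable_fun_sum _ fun σ _ =>
      (Finset.measurable_fun_prod _ fun i _ => hB _ _).const_smul _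
  have hadj : ∀ i k, Measurable fun t => (A t).adjugate i k := fun i k => by
    simp_rw [Matrix.adjugate_apply]
    refine hdet fun l m => ?_
    by_cases h : l = k
    · subst h
      simp
    · simpa [Matrix.updateRow_ne h] using hA l m
  simp only [Matrix.mulVec, dotProduct, Matrix.inv_def, Matrix.smul_apply, Ring.inverse_eq_inv',
    smul_eq_mul]
  exact Finset.measurable_fun_sum _ fun k _ => ((hdet hA).inv.mul (hadj j k)).mul (hb k)

section Gram

variable {X : Type*} {H : Type*} [NormedAddCommGroup H] [InnerProductSpace ℝ H] [CompleteSpace H]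
  [RKHS ℝ H X ℝ] {J : Type*} [Fintype J] [DecidableEq J]

/-- The values of the `p` leading features at the points `u`. -/
def featureMatrix (v : ℕ → X → ℝ) (p : ℕ) (u : J → X) : Matrix J (Fin p) ℝ :=
  Matrix.of fun j ℓ => v ℓ (u j)

/-- The kernel matrix of the points `u`. -/
noncomputable def gram (H : Type*) [NormedAddCommGroup H] [InnerProductSpace ℝ H] [CompleteSpace H]
    [RKHS ℝ H X ℝ] (u : J → X) : Matrix J J ℝ :=
  Matrix.of fun j k => kern H (u j) (u k)

/-- The matrix of the residual kernel at the points `u`. -/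
noncomputable def resGram (H : Type*) [NormedAddCommGroup H] [InnerProductSpace ℝ H]
    [CompleteSpace H] [RKHS ℝ H X ℝ] (lam : ℕ → ℝ) (v : ℕ → X → ℝ) (p : ℕ) (u : J → X) :
    Matrix J J ℝ :=
  Matrix.of fun j k => resKern H lam v p (u j) (u k)

/-- Spectral bounds for the residual kernel matrix. -/
structure ResGramBounds (H : Type*) [NormedAddCommGroup H] [InnerProductSpace ℝ H]
    [CompleteSpace H] [RKHS ℝ H X ℝ] (lam : ℕ → ℝ) (v : ℕ → X → ℝ) (p : ℕ) (u : J → X)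
    (αL αU : ℝ) : Prop where
  le : ∀ w : EuclideanSpace ℝ J,
    αL * ‖w‖ ^ 2 ≤ inner ℝ (Matrix.toLpLin 2 2 (resGram H lam v p u) w) w
  ge : ∀ w : EuclideanSpace ℝ J,
    inner ℝ (Matrix.toLpLin 2 2 (resGram H lam v p u) w) w ≤ αU * ‖w‖ ^ 2

variable {lam : ℕ → ℝ} {v : ℕ → X → ℝ} {p : ℕ} {u : J → X} {αL αU : ℝ}

theorem isSymmetric_resGram : (Matrix.toLpLin 2 2 (resGram H lam v p u) :
    EuclideanSpace ℝ J →ₗ[ℝ] EuclideanSpace ℝ J).IsSymmetric :=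
  isSymmetric_toLpLin (Matrix.ext fun _ _ => resKern_comm _ _ _ _ _)

/-- The splitting $K=V\mathcal T_GV^*+R$, in the shape in which the abstract operator bounds use it.
-/
theorem toLpLin_gram (w : EuclideanSpace ℝ J) :
    Matrix.toLpLin 2 2 (featureMatrix v p u) (Matrix.toLpLin 2 2 (TG lam p)
        (Matrix.toLpLin 2 2 (featureMatrix v p u).transpose w))
      + Matrix.toLpLin 2 2 (resGram H lam v p u) w = Matrix.toLpLin 2 2 (gram H u) w := by
  have : gram H u = featureMatrix v p u * TG lam p * (featureMatrix v p u).transpose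
      + resGram H lam v p u := by
    ext j k
    rw [Matrix.add_apply, Matrix.mul_apply]
    simp only [TG, Matrix.mul_diagonal, gram, resGram, resKern, featureMatrix, Matrix.of_apply,
      Matrix.transpose_apply]
    have : ∀ ℓ : Fin p, v ℓ (u j) * lam ℓ * v ℓ (u k) = lam ℓ * v ℓ (u j) * v ℓ (u k) :=
      fun ℓ => by ring
    simp only [this, add_sub_cancel]
  rw [this]
  simp only [Matrix.toLpLin_apply, Matrix.mulVec_mulVec, Matrix.add_mulVec, WithLp.toLp_add,
    Matrix.mul_assoc]

theorem inner_TG_nonneg (hlam : ∀ ℓ, 0 ≤ lam ℓ) (z : EuclideanSpace ℝ (Fin p)) :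
    0 ≤ inner ℝ (Matrix.toLpLin 2 2 (TG lam p) z) z := by
  rw [inner_toLpLin_self]
  refine Finset.sum_nonneg fun i _ => ?_
  rw [Finset.sum_eq_single i (fun j _ hj => by rw [TG, Matrix.diagonal_apply_ne' _ hj]; ring)
    (by simp), TG, Matrix.diagonal_apply_eq, mul_assoc]
  exact mul_nonneg (hlam _) (mul_self_nonneg _)

theorem ResGramBounds.gram_ge (h : ResGramBounds H lam v p u αL αU) (hlam : ∀ ℓ, 0 ≤ lam ℓ)
    (w : EuclideanSpace ℝ J) :
    αL * ‖w‖ ^ 2 ≤ inner ℝ (Matrix.toLpLin 2 2 (gram H u) w) w := by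
  rw [← toLpLin_gram (lam := lam) (v := v) (p := p), inner_add_left, inner_toLpLin]
  exact (h.le w).trans (le_add_of_nonneg_left (inner_TG_nonneg hlam _))

theorem ResGramBounds.gram_mulVec_inv (h : ResGramBounds H lam v p u αL αU)
    (hlam : ∀ ℓ, 0 ≤ lam ℓ) (h0 : 0 < αL) (b : J → ℝ) :
    (gram H u).mulVec ((gram H u)⁻¹.mulVec b) = b := by
  have hinj : Function.Injective (gram H u).mulVec := by
    intro w w' hw
    have h1 := h.gram_ge hlam (WithLp.toLp 2 (w - w'))
    rw [Matrix.toLpLin_apply] at h1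
    simp only [Matrix.mulVec_sub] at h1
    rw [hw, sub_self, WithLp.toLp_zero, inner_zero_left] at h1
    have h2 : ‖WithLp.toLp 2 (w - w')‖ ^ 2 = 0 := le_antisymm (by nlinarith) (sq_nonneg _)
    have h3 := norm_eq_zero.1 (pow_eq_zero_iff two_ne_zero |>.1 h2)
    exact sub_eq_zero.1 ((WithLp.toLp_eq_zero 2).1 h3)
  have hu := (Matrix.isUnit_iff_isUnit_det _).1 (Matrix.mulVec_injective_iff_isUnit.1 hinj)
  rw [Matrix.mulVec_mulVec, Matrix.mul_nonsing_inv _ hu, Matrix.one_mulVec]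

/-- Interpolation weights: the prediction at `z` of the minimum-norm interpolant with values `b`
at the points `u` is the inner product of `b` with the weights. -/
noncomputable def weights (H : Type*) [NormedAddCommGroup H] [InnerProductSpace ℝ H]
    [CompleteSpace H] [RKHS ℝ H X ℝ] (u : J → X) (z : X) : J → ℝ :=
  (gram H u)⁻¹.mulVec fun j => kern H (u j) z

/-- The dual coefficients of the minimum-norm interpolant with values `b` at the points `u`. -/
noncomputable def dualCoeff (H : Type*) [NormedAddCommGroup H] [InnerProductSpace ℝ H]
    [CompleteSpace H] [RKHS ℝ H X ℝ] (u : J → X) (b : J → ℝ) : J → ℝ :=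
  (gram H u)⁻¹.mulVec b

/-- $K^{-1}$ is symmetric, so it may act on the labels instead of on the kernel vector. -/
theorem sum_weights_mul (z : X) (b : J → ℝ) :
    ∑ j, weights H u z j * b j = ∑ j, kern H (u j) z * dualCoeff H u b j := by
  have h1 : ((gram H u)⁻¹).transpose = (gram H u)⁻¹ := by
    have : (gram H u).transpose = gram H u := Matrix.ext fun _ _ => kern_comm _ _
    rw [Matrix.transpose_nonsing_inv, this]
  change ((gram H u)⁻¹.mulVec fun j => kern H (u j) z) ⬝ᵥ b
    = (fun j => kern H (u j) z) ⬝ᵥ ((gram H u)⁻¹.mulVec b)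
  rw [Matrix.dotProduct_mulVec, ← Matrix.mulVec_transpose, h1]

/-- The deviation of the empirical covariance of the features from `N` times the identity. -/
noncomputable def covDeviation (v : ℕ → X → ℝ) (p : ℕ) (u : J → X) (N : ℝ) : ℝ :=
  ‖Matrix.toEuclideanCLM (n := Fin p) (𝕜 := ℝ)
    ((featureMatrix v p u).transpose * featureMatrix v p u - N • 1)‖

theorem norm_featureMatrix_sub_le (N : ℝ) (z : EuclideanSpace ℝ (Fin p)) :
    ‖Matrix.toLpLin 2 2 (featureMatrix v p u).transpose
      (Matrix.toLpLin 2 2 (featureMatrix v p u) z) - N • z‖ ≤ covDeviation v p u N * ‖z‖ := by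
  refine le_trans (le_of_eq ?_) (ContinuousLinearMap.le_opNorm _ z)
  congr 1
  change _ = Matrix.toLpLin 2 2 ((featureMatrix v p u).transpose * featureMatrix v p u - N • 1) z
  rw [map_sub, map_smul, Matrix.toLpLin_one]
  simp [Matrix.toLpLin_apply, Matrix.mulVec_mulVec]

theorem ResGramBounds.norm_weights_le (h : ResGramBounds H lam v p u αL αU)
    (hlam : ∀ ℓ, 0 ≤ lam ℓ) (h0 : 0 < αL) (hle : αL ≤ αU) (hU3 : αU ≤ 3 * αL) {N : ℝ} (hN : 0 < N)
    (hθ : covDeviation v p u N ≤ N / 4) (z : X) :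
    √(∑ j, weights H u z j ^ 2) ≤ 8 * (√(∑ ℓ : Fin p, v ℓ z ^ 2) / √N)
      + √(∑ j, resKern H lam v p (u j) z ^ 2) / αL := by
  have h1 := SVP.norm_weights_le (Matrix.toLpLin 2 2 (featureMatrix v p u))
    (Matrix.toLpLin 2 2 (featureMatrix v p u).transpose) (inner_toLpLin _)
    (norm_featureMatrix_sub_le N) (Matrix.toLpLin 2 2 (resGram H lam v p u)) isSymmetric_resGram
    h.le h.ge h0 hle hN hθ hU3 (inner_TG_nonneg hlam)
    (q := WithLp.toLp 2 (weights H u z)) (r := WithLp.toLp 2 fun j => resKern H lam v p (u j) z)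
    (z := WithLp.toLp 2 fun ℓ : Fin p => v ℓ z) (by
      rw [toLpLin_gram, Matrix.toLpLin_apply, weights]
      simp only
      rw [h.gram_mulVec_inv hlam h0]
      ext j
      simp only [resKern, PiLp.add_apply, Matrix.toLpLin_apply, Matrix.mulVec, dotProduct,
        featureMatrix, TG, Matrix.of_apply]
      have : ∀ ℓ : Fin p, v ℓ (u j) * (∑ m : Fin p,
          Matrix.diagonal (fun ℓ : Fin p => lam ℓ) ℓ m * v m z) = lam ℓ * v ℓ (u j) * v ℓ z :=
        fun ℓ => by
          rw [Finset.sum_eq_single ℓ (fun m _ hm => by rw [Matrix.diagonal_apply_ne' _ hm, zero_mul])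
            (by simp), Matrix.diagonal_apply_eq]
          ring
      simp [this])
  simpa [EuclideanSpace.norm_eq] using h1

end Gram

/-! ### Error of the noise-free prediction -/

section Prediction

variable {X : Type*} {H : Type*} [NormedAddCommGroup H] [InnerProductSpace ℝ H] [CompleteSpace H]
  [RKHS ℝ H X ℝ] {J : Type*} [Fintype J]
  {lam : ℕ → ℝ} {v : ℕ → X → ℝ} {p : ℕ} {u : J → X}

/-- The coefficients in the features of `∑ j, g j * k(u j, ·) - combine v s`. -/
noncomputable def errorCoeff (lam : ℕ → ℝ) (v : ℕ → X → ℝ) {p : ℕ} (u : J → X) (g : J → ℝ)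
    (s : Fin p → ℝ) (ℓ : ℕ) : ℝ :=
  lam ℓ * (∑ j, g j * v ℓ (u j)) - if h : ℓ < p then s ⟨ℓ, h⟩ else 0

/-- A bound for the squared `L²` norm of the function with coefficients `errorCoeff`. -/
noncomputable def errorBound (H : Type*) [NormedAddCommGroup H] [InnerProductSpace ℝ H]
    [CompleteSpace H] [RKHS ℝ H X ℝ] (lam : ℕ → ℝ) (v : ℕ → X → ℝ) {p : ℕ} (u : J → X) (g : J → ℝ)
    (s : Fin p → ℝ) : ℝ :=
  ∑ ℓ : Fin p, errorCoeff lam v u g s ℓ ^ 2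
    + lam p * ∑ i, ∑ j, resGram H lam v p u i j * g j * g i

theorem errorCoeff_of_lt (g : J → ℝ) (s : Fin p → ℝ) (ℓ : Fin p) :
    errorCoeff lam v u g s ℓ = lam ℓ * (∑ j, g j * v ℓ (u j)) - s ℓ := by
  simp [errorCoeff]

theorem errorCoeff_of_le (g : J → ℝ) (s : Fin p → ℝ) {ℓ : ℕ} (hℓ : p ≤ ℓ) :
    errorCoeff lam v u g s ℓ = lam ℓ * (∑ j, g j * v ℓ (u j)) := by
  simp [errorCoeff, not_lt.2 hℓ]

section Mercer

variable [MeasurableSpace X] {μ : Measure X}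

theorem IsMercerSystem.hasSum_errorCoeff (h : IsMercerSystem H μ lam v) (g : J → ℝ)
    (s : Fin p → ℝ) (z : X) : HasSum (fun ℓ => errorCoeff lam v u g s ℓ * v ℓ z)
      (∑ j, kern H (u j) z * g j - combine v s z) := by
  have h1 : HasSum (fun ℓ => lam ℓ * (∑ j, g j * v ℓ (u j)) * v ℓ z)
      (∑ j, kern H (u j) z * g j) := by
    have := hasSum_sum (s := Finset.univ) fun j (_ : j ∈ Finset.univ) =>
      (h.hasSum (u j) z).mul_right (g j)
    refine this.congr_fun fun ℓ => ?_
    rw [Finset.mul_sum, Finset.sum_mul]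
    exact Finset.sum_congr rfl fun j _ => by ring
  have h2 : HasSum (fun ℓ => (if h : ℓ < p then s ⟨ℓ, h⟩ else 0) * v ℓ z) (combine v s z) := by
    have h3 : HasSum (fun ℓ => (if h : ℓ < p then s ⟨ℓ, h⟩ else 0) * v ℓ z) _ :=
      hasSum_sum_of_ne_finset_zero (s := Finset.range p) fun ℓ hℓ => by
        rw [dif_neg (by simpa using hℓ), zero_mul]
    rw [Finset.sum_range] at h3
    simpa [combine] using h3
  refine (h1.sub h2).congr_fun fun ℓ => ?_
  rw [errorCoeff]; ring

/-- For $\ell\ge p$ one factor $\lambda_\ell$ is bounded by $\lambda_p$ (the first eigenvalue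
outside $G$), and $\sum_{\ell\ge p}\lambda_\ell(\sum_jg_jv_\ell(u_j))^2$ is the quadratic form of
the residual matrix at $g$. -/
theorem IsMercerSystem.sum_errorCoeff_sq_le (h : IsMercerSystem H μ lam v) (g : J → ℝ)
    (s : Fin p → ℝ) (S : Finset ℕ) :
    ∑ ℓ ∈ S, errorCoeff lam v u g s ℓ ^ 2 ≤ errorBound H lam v u g s := by
  have hres : HasSum (fun ℓ => if p ≤ ℓ then lam ℓ * (∑ j, g j * v ℓ (u j)) ^ 2 else 0)
      (∑ i, ∑ j, resGram H lam v p u i j * g j * g i) := by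
    have := hasSum_sum (s := Finset.univ) fun i (_ : i ∈ Finset.univ) =>
      hasSum_sum (s := Finset.univ) fun j (_ : j ∈ Finset.univ) =>
        ((h.hasSum_resKern p (u i) (u j)).mul_right (g j)).mul_right (g i)
    refine this.congr_fun fun ℓ => ?_
    split_ifs
    · rw [sq, Finset.sum_mul_sum, Finset.mul_sum]
      refine Finset.sum_congr rfl fun i _ => ?_
      rw [Finset.mul_sum]
      exact Finset.sum_congr rfl fun j _ => by ring
    · simp
  have hnn : ∀ ℓ, 0 ≤ if p ≤ ℓ then lam ℓ * (∑ j, g j * v ℓ (u j)) ^ 2 else 0 := fun ℓ => by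
    split_ifs
    · exact mul_nonneg (h.nonneg ℓ) (sq_nonneg _)
    · exact le_rfl
  have hpt : ∀ ℓ, errorCoeff lam v u g s ℓ ^ 2 ≤
      (if ℓ < p then errorCoeff lam v u g s ℓ ^ 2 else 0)
        + lam p * if p ≤ ℓ then lam ℓ * (∑ j, g j * v ℓ (u j)) ^ 2 else 0 := fun ℓ => by
    by_cases hℓ : p ≤ ℓ
    · rw [if_neg (not_lt.2 hℓ), if_pos hℓ, errorCoeff_of_le g s hℓ, zero_add, mul_pow, sq (lam ℓ),
        mul_assoc]
      exact mul_le_mul_of_nonneg_right (h.antitone hℓ) (mul_nonneg (h.nonneg ℓ) (sq_nonneg _))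
    · rw [if_pos (not_le.1 hℓ), if_neg hℓ]; simp
  calc _ ≤ ∑ ℓ ∈ S, ((if ℓ < p then errorCoeff lam v u g s ℓ ^ 2 else 0)
        + lam p * if p ≤ ℓ then lam ℓ * (∑ j, g j * v ℓ (u j)) ^ 2 else 0) :=
        Finset.sum_le_sum fun ℓ _ => hpt ℓ
    _ = ∑ ℓ ∈ S, (if ℓ < p then errorCoeff lam v u g s ℓ ^ 2 else 0)
        + lam p * ∑ ℓ ∈ S, if p ≤ ℓ then lam ℓ * (∑ j, g j * v ℓ (u j)) ^ 2 else 0 := by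
        rw [Finset.sum_add_distrib, Finset.mul_sum]
    _ ≤ _ := by
        refine add_le_add ?_ (mul_le_mul_of_nonneg_left
          (sum_le_hasSum S (fun ℓ _ => hnn ℓ) hres) (h.nonneg p))
        rw [← Finset.sum_filter, ← Finset.sum_range fun ℓ => errorCoeff lam v u g s ℓ ^ 2]
        refine Finset.sum_le_sum_of_subset_of_nonneg (fun ℓ hℓ => ?_) fun _ _ _ => sq_nonneg _
        simpa using (Finset.mem_filter.1 hℓ).2

theorem IsMercerSystem.measurable_resKern (h : IsMercerSystem H μ lam v) (p : ℕ) :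
    Measurable fun z : X × X => resKern H lam v p z.1 z.2 :=
  h.measurable_kern.sub (Finset.measurable_fun_sum _ fun ℓ _ =>
    (((h.measurable ℓ).comp measurable_fst).const_mul _).mul
      ((h.measurable ℓ).comp measurable_snd))

theorem IsMercerSystem.measurable_resGram {ι : Type*} (h : IsMercerSystem H μ lam v) (p : ℕ)
    (i j : ι) : Measurable fun u : ι → X => resGram H lam v p u i j :=
  Measurable.comp (g := fun z : X × X => resKern H lam v p z.1 z.2) (h.measurable_resKern p)
    (f := fun u : ι → X => (u i, u j)) ((measurable_pi_apply i).prodMk (measurable_pi_apply j))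

theorem IsMercerSystem.measurable_combine (h : IsMercerSystem H μ lam v) (a : Fin p → ℝ) :
    Measurable (combine v a) :=
  Finset.measurable_fun_sum _ fun ℓ _ => (h.measurable ℓ).const_mul _

variable [DecidableEq J]

theorem IsMercerSystem.measurable_dualCoeff (h : IsMercerSystem H μ lam v) {η : X → ℝ}
    (hη : Measurable η) (j : J) :
    Measurable fun u : J → X => dualCoeff H u (fun j => η (u j)) j :=
  measurable_inv_mulVec (fun j k => h.measurable_kern.comp
    ((measurable_pi_apply j).prodMk (measurable_pi_apply k)))
    (fun j => hη.comp (measurable_pi_apply j)) j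

theorem IsMercerSystem.measurable_weights (h : IsMercerSystem H μ lam v) (j : J) :
    Measurable fun w : (J → X) × X => weights H w.1 w.2 j :=
  measurable_inv_mulVec (fun j k => h.measurable_kern.comp
    (((measurable_pi_apply j).comp measurable_fst).prodMk
      ((measurable_pi_apply k).comp measurable_fst)))
    (fun j => h.measurable_kern.comp
      (((measurable_pi_apply j).comp measurable_fst).prodMk measurable_snd)) j

theorem IsMercerSystem.measurable_errorBound (h : IsMercerSystem H μ lam v) {η : X → ℝ}
    (hη : Measurable η) (s : Fin p → ℝ) : Measurable fun u : J → X =>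
      errorBound H lam v u (dualCoeff H u fun j => η (u j)) s := by
  have hd := fun j : J => h.measurable_dualCoeff hη j
  have h1 : ∀ ℓ : Fin p, Measurable fun u : J → X =>
      errorCoeff lam v u (dualCoeff H u fun j => η (u j)) s ℓ := fun ℓ => by
    simp_rw [errorCoeff_of_lt]
    have h2 : Measurable fun u : J → X => ∑ j, dualCoeff H u (fun j => η (u j)) j * v ℓ (u j) :=
      Finset.measurable_fun_sum _ fun j _ => by
        have h3 : Measurable fun u : J → X => v ℓ (u j) :=
          (h.measurable ℓ).comp (measurable_pi_apply j)
        exact (hd j).mul h3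
    exact (h2.const_mul _).sub_const _
  have h3 := fun i j : J => h.measurable_resGram p i j
  have h4 : Measurable fun u : J → X => ∑ i, ∑ j, resGram H lam v p u i j
      * dualCoeff H u (fun j => η (u j)) j * dualCoeff H u (fun j => η (u j)) i :=
    Finset.measurable_fun_sum _ fun i _ => Finset.measurable_fun_sum _ fun j _ =>
      ((h3 i j).mul (hd j)).mul (hd i)
  have h5 : Measurable fun u : J → X => ∑ ℓ : Fin p,
      errorCoeff lam v u (dualCoeff H u fun j => η (u j)) s ℓ ^ 2 :=
    Finset.measurable_fun_sum _ fun ℓ _ => (h1 ℓ).pow_const 2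
  simp only [errorBound]
  exact h5.add (h4.const_mul _)

end Mercer

/-- Follows from $\bar{\mathcal B}=\bar\alpha(\bar\alpha\mathcal I+n\mathcal T_G)^{-1}$; this is the
equation that `norm_bias_sub_le` asks of the idealized error. -/
theorem bias_mulVec_eq {n : ℕ} {αL αU : ℝ} (hlam : ∀ ℓ, 0 ≤ lam ℓ)
    (hα : 0 < harmonicMean αL αU) (a : Fin p → ℝ) :
    (bias lam p n αL αU).mulVec a
      + ((n : ℝ) / harmonicMean αL αU) • (TG lam p).mulVec ((bias lam p n αL αU).mulVec a) = a := by
  set β := harmonicMean αL αU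
  set M : Matrix (Fin p) (Fin p) ℝ := β • 1 + (n : ℝ) • TG lam p with hM
  have hMd : M = Matrix.diagonal fun ℓ : Fin p => β + n * lam ℓ := by
    ext i j
    by_cases hij : i = j
    · subst hij; simp [hM, TG]
    · simp [hM, TG, hij]
  have hu : IsUnit M.det := by
    rw [hMd, Matrix.det_diagonal, isUnit_iff_ne_zero]
    refine Finset.prod_ne_zero_iff.2 fun ℓ _ => ?_
    have := mul_nonneg (Nat.cast_nonneg (α := ℝ) n) (hlam ℓ)
    positivity
  have hb : bias lam p n αL αU = β • M⁻¹ := by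
    have h1 : (n : ℝ) • TG lam p = M - β • 1 := by rw [hM]; abel
    rw [bias, survival]
    change 1 - ((n : ℝ) • TG lam p) * M⁻¹ = _
    rw [h1, Matrix.sub_mul, Matrix.mul_nonsing_inv _ hu, smul_mul_assoc, one_mul, sub_sub_cancel]
  have h2 : M * bias lam p n αL αU = β • 1 := by
    rw [hb, mul_smul_comm, Matrix.mul_nonsing_inv _ hu]
  have h3 : β • ((bias lam p n αL αU).mulVec a
      + ((n : ℝ) / β) • (TG lam p).mulVec ((bias lam p n αL αU).mulVec a)) = β • a := by
    rw [smul_add, smul_smul, mul_div_cancel₀ _ hα.ne', ← Matrix.smul_mulVec (n : ℝ)]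
    calc _ = M.mulVec ((bias lam p n αL αU).mulVec a) := by
          rw [hM, Matrix.add_mulVec, Matrix.smul_mulVec β, Matrix.one_mulVec]
      _ = _ := by rw [Matrix.mulVec_mulVec, h2, Matrix.smul_mulVec, Matrix.one_mulVec]
  exact smul_right_injective _ hα.ne' h3

variable [DecidableEq J]

/-- The leading error coefficients are, up to sign, the true bias minus the idealized bias, giving
$4c^2$; the residual energy of the dual coefficients, times $\lambda_p$, gives the other term. Both
come from `norm_bias_sub_le`. -/
theorem ResGramBounds.errorBound_le {αL αU : ℝ} (h : ResGramBounds H lam v p u αL αU)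
    (hlam : ∀ ℓ, 0 ≤ lam ℓ) (h0 : 0 < αL) (hle : αL ≤ αU) {n : ℕ} (hn : 0 < n) {c : ℝ}
    (hc : (αU - αL) / (αU + αL) + 2 / n * covDeviation v p u n ≤ c) (hc2 : c ≤ 1 / 2)
    (a : Fin p → ℝ) {β : ℝ} (hβ : ∑ ℓ, (bias lam p n αL αU).mulVec a ℓ ^ 2 ≤ β ^ 2) :
    errorBound H lam v u (dualCoeff H u fun j => combine v a (u j))
      ((survival lam p n αL αU).mulVec a) ≤ (4 * c ^ 2 + 8 * (lam p * n / αL)) * β ^ 2 := by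
  have hU0 : 0 < αU := by linarith
  have hn' : (0 : ℝ) < n := Nat.cast_pos.2 hn
  have hα : 0 < harmonicMean αL αU := by unfold harmonicMean; positivity
  set g := dualCoeff H u fun j => combine v a (u j) with hg
  set e := (bias lam p n αL αU).mulVec a with he
  have hρ : 0 ≤ (αU - αL) / (αU + αL) := div_nonneg (by linarith) (by linarith)
  have hθ0 : 0 ≤ covDeviation v p u n := norm_nonneg _
  have hθ : covDeviation v p u n ≤ n := by
    have h1 : 2 / n * covDeviation v p u n ≤ 1 / 2 := by linarith
    rw [div_mul_eq_mul_div, div_le_iff₀ hn'] at h1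
    linarith
  obtain ⟨h1, h2⟩ := norm_bias_sub_le (Matrix.toLpLin 2 2 (featureMatrix v p u))
    (Matrix.toLpLin 2 2 (featureMatrix v p u).transpose) (inner_toLpLin _)
    (norm_featureMatrix_sub_le (n : ℝ)) (Matrix.toLpLin 2 2 (resGram H lam v p u))
    isSymmetric_resGram h.le h.ge h0 hle hn' hθ0 hθ hc hc2 (inner_TG_nonneg hlam)
    (g := WithLp.toLp 2 g) (a := WithLp.toLp 2 a) (e := WithLp.toLp 2 e) (by
      rw [toLpLin_gram, Matrix.toLpLin_apply, hg, dualCoeff]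
      simp only
      rw [h.gram_mulVec_inv hlam h0]
      ext j
      simp [Matrix.mulVec, dotProduct, featureMatrix, combine, mul_comm]) (by
      rw [Matrix.toLpLin_apply, ← WithLp.toLp_smul, ← WithLp.toLp_add]
      rw [he, bias_mulVec_eq hlam hα])
  have hs : (survival lam p n αL αU).mulVec a = a - e := by
    rw [he, bias, Matrix.sub_mulVec, Matrix.one_mulVec, sub_sub_cancel]
  have hne : ‖WithLp.toLp 2 e‖ ^ 2 ≤ β ^ 2 := by
    rw [EuclideanSpace.norm_sq_eq]
    simpa using hβ
  have h3 : ∑ ℓ : Fin p, errorCoeff lam v u g ((survival lam p n αL αU).mulVec a) ℓ ^ 2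
      = ‖WithLp.toLp 2 a - Matrix.toLpLin 2 2 (TG lam p)
        (Matrix.toLpLin 2 2 (featureMatrix v p u).transpose (WithLp.toLp 2 g))
        - WithLp.toLp 2 e‖ ^ 2 := by
    rw [EuclideanSpace.norm_sq_eq]
    refine Finset.sum_congr rfl fun ℓ _ => ?_
    rw [errorCoeff_of_lt, hs, Real.norm_eq_abs, sq_abs]
    simp only [Matrix.toLpLin_apply, PiLp.sub_apply, TG, Matrix.mulVec_diagonal, Pi.sub_apply]
    have : (featureMatrix v p u).transpose.mulVec g ℓ = ∑ j, g j * v ℓ (u j) := by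
      simp [Matrix.mulVec, dotProduct, featureMatrix, mul_comm]
    rw [this]
    ring
  rw [errorBound, h3]
  rw [inner_toLpLin_self] at h2
  have h4 : lam p * ∑ i, ∑ j, resGram H lam v p u i j * g j * g i
      ≤ lam p * (8 * n / αL * β ^ 2) := by
    refine mul_le_mul_of_nonneg_left (h2.trans ?_) (hlam p)
    gcongr
  have h5 := pow_le_pow_left₀ (norm_nonneg _) h1 2
  have hc0 : 0 ≤ c := le_trans (by positivity) hc
  calc _ ≤ (2 * c * ‖WithLp.toLp 2 e‖) ^ 2 + lam p * (8 * n / αL * β ^ 2) := add_le_add h5 h4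
    _ = 4 * c ^ 2 * ‖WithLp.toLp 2 e‖ ^ 2 + 8 * (lam p * n / αL) * β ^ 2 := by ring
    _ ≤ 4 * c ^ 2 * β ^ 2 + 8 * (lam p * n / αL) * β ^ 2 := by gcongr
    _ = _ := by ring

section SupNorm

variable [MeasurableSpace X] {μ : Measure X}

theorem ae_abs_le_supNorm {f : X → ℝ} (hf : MemLp f ∞ μ) : ∀ᵐ x ∂μ, |f x| ≤ supNorm μ f := by
  filter_upwards [ae_le_eLpNormEssSup (f := f) (μ := μ)] with x hx
  rw [← eLpNorm_exponent_top] at hx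
  have := ENNReal.toReal_mono hf.eLpNorm_ne_top hx
  simpa [supNorm] using this

/-- Parseval and $L^2\le L^\infty$ under a probability measure; through this, $b$ bounds the
coefficients of the bias. -/
theorem IsMercerSystem.sum_sq_le_supNorm [IsProbabilityMeasure μ] (h : IsMercerSystem H μ lam v)
    (hp : ∀ ℓ < p, 0 < lam ℓ) (e : Fin p → ℝ) (he : MemLp (combine v e) ∞ μ) :
    ∑ ℓ, e ℓ ^ 2 ≤ supNorm μ (combine v e) ^ 2 := by
  set b : ℕ → ℝ := fun ℓ => if h : ℓ < p then e ⟨ℓ, h⟩ else 0 with hb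
  have hcomb : ∀ x, ∑ ℓ ∈ Finset.range p, b ℓ * v ℓ x = combine v e x := fun x => by
    rw [Finset.sum_range, combine]
    exact Finset.sum_congr rfl fun ℓ _ => by simp [hb]
  obtain ⟨h1, h2⟩ := h.integral_sum_sq (Finset.range p) b
    fun ℓ hℓ _ => hp ℓ (Finset.mem_range.1 hℓ)
  simp_rw [hcomb] at h1 h2
  rw [Finset.sum_range] at h2
  have h3 : ∑ ℓ, e ℓ ^ 2 = ∫ x, combine v e x ^ 2 ∂μ := by
    rw [h2]
    exact Finset.sum_congr rfl fun ℓ _ => by simp [hb]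
  rw [h3]
  calc _ ≤ ∫ _, supNorm μ (combine v e) ^ 2 ∂μ := by
        refine integral_mono_ae h1 (integrable_const _) ?_
        filter_upwards [ae_abs_le_supNorm he] with x hx
        rw [← sq_abs]
        gcongr
    _ = _ := by simp

end SupNorm

end Prediction

/-! ### From leave-one-out predictions to the signs of the dual coefficients -/

section LeaveOneOut

variable {X : Type*} {H : Type*} [NormedAddCommGroup H] [InnerProductSpace ℝ H] [CompleteSpace H]
  [RKHS ℝ H X ℝ] {lam : ℕ → ℝ} {v : ℕ → X → ℝ} {p n : ℕ} {αL αU : ℝ}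

theorem ResGramBounds.of_residualGram [MeasurableSpace X] {μ : Measure X} (h : IsMercerSystem H μ lam v)
    (hp : ∀ ℓ < p, 0 < lam ℓ) {x : Fin n → X}
    (hL : αL • ContinuousLinearMap.id ℝ (EuclideanSpace ℝ (Fin n)) ≤ residualGram H v p x)
    (hU : residualGram H v p x ≤ αU • ContinuousLinearMap.id ℝ (EuclideanSpace ℝ (Fin n))) :
    ResGramBounds H lam v p x αL αU := by
  have hR : ∀ w, residualGram H v p x w = Matrix.toLpLin 2 2 (resGram H lam v p x) w := fun w => by
    ext i
    rw [h.residualGram_apply hp]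
    rfl
  refine ⟨fun w => ?_, fun w => ?_⟩
  · have := ((ContinuousLinearMap.le_def _ _).1 hL).inner_nonneg_left w
    simp only [sub_apply, smul_apply,
      ContinuousLinearMap.id_apply, inner_sub_left, real_inner_smul_left,
      real_inner_self_eq_norm_sq, hR] at this
    linarith
  · have := ((ContinuousLinearMap.le_def _ _).1 hU).inner_nonneg_left w
    simp only [sub_apply, smul_apply,
      ContinuousLinearMap.id_apply, inner_sub_left, real_inner_smul_left,
      real_inner_self_eq_norm_sq, hR] at this
    linarith

/-- Were $\lambda_p=0$, the residual would vanish, against $\alpha_L>0$ and $n>0$; the eigenvalues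
before it are at least as large. -/
theorem IsMercerSystem.lam_pos [MeasurableSpace X] {μ : Measure X}
    (h : IsMercerSystem H μ lam v) (hn : 0 < n) (h0 : 0 < αL) {x : Fin n → X}
    (hL : αL • ContinuousLinearMap.id ℝ (EuclideanSpace ℝ (Fin n)) ≤ residualGram H v p x)
    {ℓ : ℕ} (hℓ : ℓ < p) : 0 < lam ℓ := by
  refine lt_of_lt_of_le ((h.nonneg p).lt_of_ne' fun hp => ?_) (h.antitone hℓ.le)
  set w : EuclideanSpace ℝ (Fin n) := EuclideanSpace.single ⟨0, hn⟩ 1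
  have := ((ContinuousLinearMap.le_def _ _).1 hL).inner_nonneg_left w
  rw [residualGram, h.residual_eq_zero hp] at this
  simp only [ContinuousLinearMap.zero_comp, zero_sub, neg_apply,
    smul_apply, ContinuousLinearMap.id_apply, inner_neg_left,
    real_inner_smul_left, real_inner_self_eq_norm_sq] at this
  have hw : ‖w‖ = 1 := by simp [w]
  rw [hw] at this
  linarith

variable {x : Fin n → X}

theorem ResGramBounds.alpha_le (h : ResGramBounds H lam v p x αL αU) (hn : 0 < n) : αL ≤ αU := by
  have := (h.le (EuclideanSpace.single ⟨0, hn⟩ 1)).trans (h.ge _)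
  simpa using this

theorem ResGramBounds.leaveOneOut (h : ResGramBounds H lam v p x αL αU) (i : Fin n) :
    ResGramBounds H lam v p (fun j : {j : Fin n // j ≠ i} => x j) αL αU := by
  have key : ∀ w : EuclideanSpace ℝ {j : Fin n // j ≠ i}, ∃ w' : EuclideanSpace ℝ (Fin n),
      ‖w'‖ ^ 2 = ‖w‖ ^ 2 ∧ inner ℝ (Matrix.toLpLin 2 2 (resGram H lam v p x) w') w'
        = inner ℝ (Matrix.toLpLin 2 2
          (resGram H lam v p fun j : {j : Fin n // j ≠ i} => x j) w) w := by
    intro w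
    -- Principal submatrices inherit spectral bounds: extend the test vector by zero.
    refine ⟨WithLp.toLp 2 fun k => if hk : k ≠ i then w ⟨k, hk⟩ else 0, ?_, ?_⟩
    · rw [EuclideanSpace.norm_sq_eq, EuclideanSpace.norm_sq_eq,
        Fintype.sum_eq_add_sum_subtype_ne _ i]
      have : ∀ j : {j : Fin n // j ≠ i}, (j : Fin n) ≠ i := fun j => j.2
      simp [this]
    · rw [inner_toLpLin_self, inner_toLpLin_self, Fintype.sum_eq_add_sum_subtype_ne _ i]
      have : ∀ j : {j : Fin n // j ≠ i}, (j : Fin n) ≠ i := fun j => j.2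
      simp only [ne_eq, not_true_eq_false, dite_false, mul_zero, Finset.sum_const_zero, zero_add]
      refine Finset.sum_congr rfl fun j _ => ?_
      rw [Fintype.sum_eq_add_sum_subtype_ne _ i]
      simp [this, resGram]
  refine ⟨fun w => ?_, fun w => ?_⟩ <;> obtain ⟨w', h1, h2⟩ := key w <;> rw [← h1, ← h2]
  exacts [h.le w', h.ge w']

/-- The off-diagonal part of a row of the residual kernel matrix is small. -/
theorem ResGramBounds.sqrt_sum_sq_le (h : ResGramBounds H lam v p x αL αU)
    (hle : αL ≤ αU) (i : Fin n) :
    √(∑ j : {j : Fin n // j ≠ i}, resKern H lam v p (x j) (x i) ^ 2) ≤ αU - αL := by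
  -- Subtracting $\alpha_LI$ leaves the off-diagonal entries unchanged and brings the operator norm
  -- down to $\alpha_U-\alpha_L$, which bounds every column.
  set T : EuclideanSpace ℝ (Fin n) →ₗ[ℝ] EuclideanSpace ℝ (Fin n) :=
    Matrix.toLpLin 2 2 (resGram H lam v p x) - αL • LinearMap.id with hT
  have hTa : ∀ w, T w = Matrix.toLpLin 2 2 (resGram H lam v p x) w - αL • w := fun w => rfl
  have hsym : T.IsSymmetric := fun u w => by
    rw [hTa, hTa, inner_sub_left, inner_sub_right, isSymmetric_resGram, real_inner_smul_left,
      real_inner_smul_right]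
  have hin : ∀ w, inner ℝ (T w) w = inner ℝ (Matrix.toLpLin 2 2 (resGram H lam v p x) w) w
      - αL * ‖w‖ ^ 2 := fun w => by
    rw [hTa, inner_sub_left, real_inner_smul_left, real_inner_self_eq_norm_sq]
  have h1 := norm_apply_le_of_inner_le T hsym (αU := αU - αL)
    (fun w => by rw [hin]; linarith [h.le w]) (fun w => by rw [hin]; linarith [h.ge w])
    (by linarith) (EuclideanSpace.single i 1)
  rw [PiLp.norm_single, norm_one, mul_one] at h1
  refine le_trans ?_ h1
  rw [EuclideanSpace.norm_eq]
  refine Real.sqrt_le_sqrt ?_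
  rw [Fintype.sum_eq_add_sum_subtype_ne _ i]
  refine le_add_of_nonneg_of_le (sq_nonneg _) (le_of_eq (Finset.sum_congr rfl fun j _ => ?_))
  rw [hTa, Real.norm_eq_abs, sq_abs]
  simp [Matrix.toLpLin_apply, resGram, j.2]

/-- With $z$ equal to $1$ at $i$ and to minus the interpolation weights elsewhere, $Kz=s\,e_i$ with
Schur complement $s>0$. Pairing with $y=Kg$ gives $s\,g_i=y_i-t_i$, so $s\,y_ig_i=1-y_it_i\ge0$. -/
theorem ResGramBounds.solutionsCoincide (h : ResGramBounds H lam v p x αL αU)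
    (hlam : ∀ ℓ, 0 ≤ lam ℓ) (h0 : 0 < αL) {y : Fin n → ℝ} (hy : ∀ i, y i = 1 ∨ y i = -1)
    (hpred : ∀ i, |∑ j : {j : Fin n // j ≠ i},
      weights H (fun j : {j : Fin n // j ≠ i} => x j) (x i) j * y j| < 1) :
    SolutionsCoincide H x y := by
  set g := dualCoeff H x y with hg
  have hsol : (gram H x).mulVec g = y := h.gram_mulVec_inv hlam h0 y
  have hsol' : ∀ i, ∑ j, kern H (x i) (x j) * g j = y i := fun i => congrFun hsol i
  refine solutionsCoincide_of_dual g hsol' (fun i => ?_) hy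
  set u : {j : Fin n // j ≠ i} → X := fun j => x j with hu
  set q := weights H u (x i) with hq
  have hq1 : ∀ k : {j : Fin n // j ≠ i}, ∑ j, kern H (u k) (u j) * q j = kern H (u k) (x i) :=
    fun k => congrFun ((h.leaveOneOut i).gram_mulVec_inv hlam h0 fun j => kern H (u j) (x i)) k
  set z : Fin n → ℝ := fun k => if hk : k ≠ i then -q ⟨k, hk⟩ else 1 with hz
  have hzi : z i = 1 := by simp [hz]
  have hzj : ∀ j : {j : Fin n // j ≠ i}, z j = -q j := fun j => by simp [hz, j.2]
  have hKz : ∀ k, k ≠ i → ∑ j, kern H (x k) (x j) * z j = 0 := fun k hk => by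
    rw [Fintype.sum_eq_add_sum_subtype_ne _ i, hzi]
    simp only [hzj, mul_neg, Finset.sum_neg_distrib]
    have := hq1 ⟨k, hk⟩
    simp only [hu] at this
    rw [this]; ring
  set s := ∑ j, kern H (x i) (x j) * z j with hs
  have hs0 : 0 < s := by
    have h1 := h.gram_ge hlam (WithLp.toLp 2 z)
    have h2 : inner ℝ (Matrix.toLpLin 2 2 (gram H x) (WithLp.toLp 2 z)) (WithLp.toLp 2 z) = s := by
      rw [inner_toLpLin_self]
      simp only [← Finset.sum_mul]
      rw [Finset.sum_eq_single i _ (by simp), hzi, mul_one]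
      · rfl
      · intro k _ hk
        have := hKz k hk
        simp only [gram, Matrix.of_apply]
        rw [this, zero_mul]
    have h3 : 1 ≤ ‖WithLp.toLp 2 z‖ ^ 2 := by
      rw [EuclideanSpace.norm_sq_eq]
      refine le_trans ?_ (Finset.single_le_sum (f := fun k => ‖(WithLp.toLp 2 z).ofLp k‖ ^ 2)
        (fun _ _ => sq_nonneg _) (Finset.mem_univ i))
      simp [hzi]
    rw [h2] at h1
    nlinarith
  have hzy : ∑ k, z k * y k = s * g i := by
    have h1 : ∑ k, z k * y k = ∑ j, g j * ∑ k, kern H (x j) (x k) * z k := by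
      simp only [← hsol', Finset.mul_sum]
      rw [Finset.sum_comm]
      refine Finset.sum_congr rfl fun j _ => Finset.sum_congr rfl fun k _ => ?_
      rw [kern_comm (x k)]; ring
    rw [h1, Finset.sum_eq_single i (fun k _ hk => by rw [hKz k hk, mul_zero]) (by simp), mul_comm]
  rw [Fintype.sum_eq_add_sum_subtype_ne _ i, hzi] at hzy
  simp only [hzj, neg_mul, Finset.sum_neg_distrib, one_mul] at hzy
  have h1 := abs_lt.1 (hpred i)
  change -1 < ∑ j, q j * y j ∧ ∑ j, q j * y j < 1 at h1
  set t := ∑ j, q j * y j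
  have h2 : s * (y i * g i) = 1 - y i * t := by
    have : y i * y i = 1 := by rcases hy i with h | h <;> rw [h] <;> norm_num
    linear_combination (-y i) * hzy + this
  have h3 : 0 ≤ s * (y i * g i) := by
    rw [h2]
    rcases hy i with h | h <;> rw [h] <;> linarith
  exact nonneg_of_mul_nonneg_right h3 hs0

end LeaveOneOut

/-- The arithmetic of the error budget: `A` is the noise-free prediction, `S'` its ideal value, `E`
the noise, `Q` the norm of the weights, `D` the squared coefficient error. The noise costs
$72=3\cdot8\cdot3$ (from $\sqrt6\le3$, the factor $8$ in `hQ`, and $\sqrt8\le3$); $144=2\cdot72$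
keeps the total within half of the margin $b/\kappa$. -/
theorem abs_prediction_lt_one {κ w b ρ c Λ N R Q D S S' A E L q : ℝ} (hκ : 0 < κ) (hw : 1 ≤ w)
    (hb : 0 < b) (hρ : 0 ≤ ρ) (hc : 0 ≤ c) (hΛ : 0 ≤ Λ)
    (hsum : 1 / b * √(R * L / N) + ρ * (√L / b) + √(Λ * L) + c * √L ≤ 1 / (144 * w * κ))
    (hN : 0 < N) (hR : 0 ≤ R) (hq : q ≤ √(8 * w ^ 2 * R))
    (hQ : Q ≤ 8 * (q / √N) + 4 * ρ) (hD : D ≤ (4 * c ^ 2 + 8 * Λ) * b ^ 2)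
    (hS : b ≤ κ * (1 - S)) (hS' : |S'| ≤ S) (hA : |A - S'| ≤ √(6 * L) * w * √D)
    (hE : |E| ≤ √(6 * L) * Q) : |A + E| < 1 := by
  have h6 : √(6 * L) ≤ 3 * √L := by
    rw [Real.sqrt_mul (by norm_num)]
    have : √6 ≤ 3 := by rw [Real.sqrt_le_left (by norm_num)]; norm_num
    gcongr
  have hsD : √D ≤ b * (2 * c + 3 * √Λ) := by
    rw [Real.sqrt_le_left (by positivity)]
    refine hD.trans ?_
    have := Real.sq_sqrt hΛ
    have h1 : 0 ≤ c * √Λ := by positivity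
    rw [mul_pow, mul_comm (b ^ 2)]
    gcongr
    nlinarith
  have hq3 : q / √N ≤ 3 * w * √(R / N) := by
    rw [div_le_iff₀ (Real.sqrt_pos.2 hN), mul_assoc, ← Real.sqrt_mul (by positivity),
      div_mul_cancel₀ _ hN.ne']
    refine hq.trans ?_
    rw [Real.sqrt_mul (by positivity), Real.sqrt_mul (by norm_num), Real.sqrt_sq (by linarith)]
    have : √8 ≤ 3 := by rw [Real.sqrt_le_left (by norm_num)]; norm_num
    gcongr
  have h1 : √(R * L / N) = √(R / N) * √L := by
    rw [← Real.sqrt_mul (by positivity)]; congr 1; ring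
  have h2 : √(Λ * L) = √Λ * √L := Real.sqrt_mul hΛ L
  rw [h1, h2] at hsum
  set l := √L
  set r := √(R / N)
  set m := √Λ
  have hl : 0 ≤ l := Real.sqrt_nonneg _
  have hr : 0 ≤ r := Real.sqrt_nonneg _
  have hm : 0 ≤ m := Real.sqrt_nonneg _
  have hA' : |A - S'| ≤ 9 * w * b * (m * l + c * l) := by
    calc _ ≤ √(6 * L) * w * √D := hA
      _ ≤ (3 * l) * w * (b * (2 * c + 3 * m)) := by gcongr
      _ ≤ (3 * l) * w * (b * (3 * c + 3 * m)) := by gcongr; norm_num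
      _ = _ := by ring
  have hE' : |E| ≤ 72 * w * b * (1 / b * (r * l) + ρ * (l / b)) := by
    have hQ' : Q ≤ 24 * w * (r + ρ) := by nlinarith
    calc _ ≤ √(6 * L) * Q := hE
      _ ≤ √(6 * L) * (24 * w * (r + ρ)) := by gcongr
      _ ≤ (3 * l) * (24 * w * (r + ρ)) := by gcongr
      _ = _ := by field_simp; ring
  have hSb : S ≤ 1 - b / κ := by
    have : b / κ ≤ 1 - S := by rw [div_le_iff₀ hκ]; linarith
    linarith
  have htot : 72 * w * b * (1 / b * (r * l) + ρ * (l / b) + m * l + c * l) ≤ b / κ / 2 := by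
    calc _ ≤ 72 * w * b * (1 / (144 * w * κ)) := by gcongr
      _ = _ := by field_simp; norm_num
  have h3 : 9 * w * b * (m * l + c * l) ≤ 72 * w * b * (m * l + c * l) := by gcongr; norm_num
  have h4 : 0 < b / κ := by positivity
  calc |A + E| = |S' + (A - S') + E| := by ring_nf
    _ ≤ |S'| + |A - S'| + |E| := abs_add_three _ _ _
    _ < 1 := by linarith

/-! ### Union bound and conclusion -/

section Main

variable {X Ω : Type*} [MeasurableSpace X] [MeasurableSpace Ω] {P : Measure Ω}
  {μ : Measure X}
  {H : Type*} [NormedAddCommGroup H] [InnerProductSpace ℝ H] [CompleteSpace H] [RKHS ℝ H X ℝ]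
  {lam : ℕ → ℝ} {v : ℕ → X → ℝ} {p n : ℕ} {σ2 : ℝ≥0} {η : X → ℝ}
  {x : Fin n → Ω → X} {y : Fin n → Ω → ℝ}

theorem IsSample.measure_lt_sum_sq_le [IsProbabilityMeasure μ]
    (hs : IsSample P μ η x y) (h : IsMercerSystem H μ lam v)
    (hf : IndepSubGaussianFeatures μ lam v σ2) (hp : ∀ ℓ < p, 0 < lam ℓ) (i : Fin n) :
    P {ω | 8 * (σ2 + 1) * p < ∑ ℓ : Fin p, v ℓ (x i ω) ^ 2} ≤ ENNReal.ofReal (Real.exp (-p)) := by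
  have hm : MeasurableSet {z | 8 * ((σ2 : ℝ) + 1) * p < ∑ ℓ : Fin p, v ℓ z ^ 2} :=
    measurableSet_lt measurable_const
      (Finset.measurable_fun_sum _ fun ℓ _ => (h.measurable ℓ).pow_const 2)
  have := hf.measure_lt_sum_sq_le h.measurable hp
  rwa [← hs.law i, Measure.map_apply (hs.measurable_x i) hm] at this

theorem IsSample.measure_lt_abs_bias_le [IsProbabilityMeasure P]
    [IsProbabilityMeasure μ] (hs : IsSample P μ η x y) (hη : Measurable η)
    (h : IsMercerSystem H μ lam v) (hf : IndepSubGaussianFeatures μ lam v σ2)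
    (hp : ∀ ℓ < p, 0 < lam ℓ) (s : Fin p → ℝ) {τ : ℝ} (hτ : 0 ≤ τ) (i : Fin n) :
    P {ω | τ * √(σ2 + 1) * √(errorBound H lam v (fun j : {j : Fin n // j ≠ i} => x j ω)
        (dualCoeff H (fun j : {j : Fin n // j ≠ i} => x j ω) fun j => η (x j ω)) s)
      < |∑ j : {j : Fin n // j ≠ i}, kern H (x j ω) (x i ω) *
          dualCoeff H (fun j : {j : Fin n // j ≠ i} => x j ω) (fun j => η (x j ω)) j
        - combine v s (x i ω)|} ≤ ENNReal.ofReal (2 * Real.exp (-(τ ^ 2 / 2))) := by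
  have hk : ∀ j : {j : Fin n // j ≠ i},
      Measurable fun w : ({j : Fin n // j ≠ i} → X) × X => kern H (w.1 j) w.2 := fun j =>
    Measurable.comp (g := fun z : X × X => kern H z.1 z.2) h.measurable_kern
      (f := fun w : ({j : Fin n // j ≠ i} → X) × X => (w.1 j, w.2))
      (((measurable_pi_apply j).comp measurable_fst).prodMk measurable_snd)
  have hB : MeasurableSet {w : ({j : Fin n // j ≠ i} → X) × X |
      τ * √(σ2 + 1) * √(errorBound H lam v w.1 (dualCoeff H w.1 fun j => η (w.1 j)) s)
      < |∑ j, kern H (w.1 j) w.2 * dualCoeff H w.1 (fun j => η (w.1 j)) j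
        - combine v s w.2|} := by
    refine measurableSet_lt ?_ ?_
    · exact (((h.measurable_errorBound hη s).comp measurable_fst).sqrt).const_mul _
    · refine Measurable.abs (Measurable.sub (Finset.measurable_fun_sum _ fun j _ => ?_)
        ((h.measurable_combine s).comp measurable_snd))
      exact (hk j).mul ((h.measurable_dualCoeff hη j).comp measurable_fst)
  -- With the other points frozen at `u`, the error is a fixed combination of features evaluated at
  -- a fresh point.
  refine measure_leaveOneOut_le hs.measurable_x hs.iIndepFun_x i hB fun u => ?_
  rw [hs.law i]
  have hE : 0 ≤ errorBound H lam v u (dualCoeff H u fun j => η (u j)) s := by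
    have h1 : ∑ ℓ ∈ (∅ : Finset ℕ), errorCoeff lam v u (dualCoeff H u fun j => η (u j)) s ℓ ^ 2
        ≤ errorBound H lam v u (dualCoeff H u fun j => η (u j)) s := h.sum_errorCoeff_sq_le _ s ∅
    simpa using h1
  refine hf.measure_lt_abs_le (D := √(errorBound H lam v u (dualCoeff H u fun j => η (u j)) s))
    h.measurable (fun ℓ hℓ => ?_) (Real.sqrt_nonneg _) (fun S => ?_)
    (h.hasSum_errorCoeff (u := u) (dualCoeff H u fun j => η (u j)) s) hτ
  · by_contra hneg
    have h0 : lam ℓ = 0 := le_antisymm (not_lt.1 hneg) (h.nonneg ℓ)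
    by_cases hℓp : ℓ < p
    · exact hneg (hp ℓ hℓp)
    · exact hℓ (by rw [errorCoeff_of_le _ _ (not_lt.1 hℓp), h0, zero_mul])
  · rw [Real.sq_sqrt hE]
    exact h.sum_errorCoeff_sq_le _ s S

theorem IsSample.measure_lt_abs_weighted_noise_le [IsProbabilityMeasure P]
    (hs : IsSample P μ η x y) (hη : Measurable η)
    (h : IsMercerSystem H μ lam v) {τ : ℝ} (hτ : 0 ≤ τ) (i : Fin n) :
    P {ω | τ * √(∑ j, weights H (fun j : {j : Fin n // j ≠ i} => x j ω) (x i ω) j ^ 2)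
      < |∑ j : {j : Fin n // j ≠ i}, weights H (fun j : {j : Fin n // j ≠ i} => x j ω) (x i ω) j
        * (y j ω - η (x j ω))|} ≤ ENNReal.ofReal (2 * Real.exp (-(τ ^ 2 / 2))) := by
  -- Weight zero at `i` removes the left-out label, so the full-sample Hoeffding bound applies
  -- although the weights depend on $x_i$ too.
  set q : (Fin n → X) → Fin n → ℝ := fun u k =>
    if hk : k ≠ i then weights H (fun j : {j : Fin n // j ≠ i} => u j) (u i) ⟨k, hk⟩ else 0 with hq
  have hqm : Measurable q := by
    refine measurable_pi_lambda _ fun k => ?_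
    by_cases hk : k ≠ i
    · simp only [hq, dif_pos hk]
      exact Measurable.comp
        (g := fun w : ({j : Fin n // j ≠ i} → X) × X => weights H w.1 w.2 ⟨k, hk⟩)
        (h.measurable_weights _)
        (f := fun u : Fin n → X => ((fun j : {j : Fin n // j ≠ i} => u j), u i))
        ((measurable_pi_lambda _ fun j => measurable_pi_apply _).prodMk (measurable_pi_apply i))
    · simp only [hq, dif_neg hk]
      exact measurable_const
  have h1 := hs.measure_lt_abs_noise_le hη hqm hτ
  refine le_trans (le_of_eq ?_) h1
  congr 1
  ext ω
  have hj : ∀ j : {j : Fin n // j ≠ i}, (j : Fin n) ≠ i := fun j => j.2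
  rw [Set.mem_ofPred_eq, Set.mem_ofPred_eq, Fintype.sum_eq_add_sum_subtype_ne _ i,
    Fintype.sum_eq_add_sum_subtype_ne _ i]
  simp [hq, hj]

theorem SamplingAssumption.exists_mem {a : Fin p → ℝ} {δ αL αU c κ : ℝ}
    (hA : SamplingAssumption H P μ lam v a x δ αL αU c κ) :
    ∃ ω, (αL • ContinuousLinearMap.id ℝ (EuclideanSpace ℝ (Fin n)) ≤ residualGram H v p (x · ω) ∧
      residualGram H v p (x · ω) ≤ αU • ContinuousLinearMap.id ℝ (EuclideanSpace ℝ (Fin n))) ∧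
    ∀ i, (αU - αL) / (αU + αL) + 2 / n * looDeviation v p (x · ω) i ≤ c := by
  by_contra! hne
  have h1 := hA.concentration
  have h2 := hA.delta_lt
  have h3 : {ω | (αL • ContinuousLinearMap.id ℝ (EuclideanSpace ℝ (Fin n))
        ≤ residualGram H v p (x · ω) ∧
      residualGram H v p (x · ω) ≤ αU • ContinuousLinearMap.id ℝ (EuclideanSpace ℝ (Fin n))) ∧
      ∀ i, (αU - αL) / (αU + αL) + 2 / n * looDeviation v p (x · ω) i ≤ c} = ∅ := by
    ext ω
    simp only [Set.mem_ofPred_eq, Set.mem_empty_iff_false, iff_false]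
    rintro ⟨h4, h5⟩
    obtain ⟨i, hi⟩ := hne ω h4
    exact absurd (h5 i) (not_le.2 hi)
  rw [h3, measureReal_empty] at h1
  linarith

/-- The probability bound behind the coincidence of the two problems. -/
theorem le_measureReal_solutionsCoincide [IsProbabilityMeasure P] [IsProbabilityMeasure μ]
    (h : IsMercerSystem H μ lam v)
    (hf : IndepSubGaussianFeatures μ lam v σ2) {a : Fin p → ℝ}
    (hs : IsSample P μ (combine v a) x y) {δ αL αU c κ b : ℝ} (hκ : 0 < κ) (hn : 2 ≤ n)
    (hA : SamplingAssumption H P μ lam v a x δ αL αU c κ)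
    (hb : b = supNorm μ (biasFun lam v a n αL αU)) (hb0 : 0 < b)
    (hsum : 1 / b * √(p * Real.log n / n) + (αU - αL) / (αU + αL) * (√(Real.log n) / b)
      + √(lam p * n * Real.log n / αL) + c * √(Real.log n) ≤ 1 / (144 * √(σ2 + 1) * κ)) :
    1 - δ - n * Real.exp (-p) - 3 / n ≤ P.real {ω | SolutionsCoincide H (x · ω) (y · ω)} := by
  have hn0 : 0 < n := by omega
  have hn' : (0 : ℝ) < n := Nat.cast_pos.2 hn0
  have h0 := hA.alpha_pos
  have hη := h.measurable_combine a
  -- One sample in the good event, which is nonempty because $\delta<1/2$, suffices to deduce the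
  -- deterministic relations between the parameters.
  obtain ⟨ω₀, ⟨hL₀, hU₀⟩, hc₀⟩ := hA.exists_mem
  have hp : ∀ ℓ < p, 0 < lam ℓ := fun ℓ hℓ => h.lam_pos hn0 h0 hL₀ hℓ
  have hle : αL ≤ αU := (ResGramBounds.of_residualGram h hp hL₀ hU₀).alpha_le hn0
  have hρ0 : 0 ≤ (αU - αL) / (αU + αL) := div_nonneg (by linarith) (by linarith)
  have hρc : (αU - αL) / (αU + αL) ≤ c := by
    refine le_trans (le_add_of_nonneg_right ?_) (hc₀ ⟨0, hn0⟩)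
    exact mul_nonneg (by positivity) (norm_nonneg _)
  have hU3 : αU ≤ 3 * αL := by
    have h1 : (αU - αL) / (αU + αL) ≤ 1 / 2 := hρc.trans hA.c_le
    rw [div_le_div_iff₀ (by linarith) (by norm_num)] at h1
    linarith
  have hlog : 0 ≤ Real.log n := Real.log_natCast_nonneg n
  -- Chosen so that each tail $e^{-\tau^2/2}$ equals $n^{-3}$.
  set τ := √(6 * Real.log n) with hτ
  have hτ2 : τ ^ 2 / 2 = 3 * Real.log n := by rw [hτ, Real.sq_sqrt (by positivity)]; ring
  have hτ0 : 0 ≤ τ := Real.sqrt_nonneg _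
  have hexp : Real.exp (-(τ ^ 2 / 2)) = 1 / (n : ℝ) ^ 3 := by
    rw [hτ2, Real.exp_neg, mul_comm, Real.exp_mul, Real.exp_log hn', one_div]
    norm_cast
  set S := (survival lam p n αL αU).mulVec a with hS
  set others : Ω → (i : Fin n) → {j : Fin n // j ≠ i} → X := fun ω i j => x j ω with hothers
  set B1 : Fin n → Set Ω := fun i =>
    {ω | 8 * ((σ2 : ℝ) + 1) * p < ∑ ℓ : Fin p, v ℓ (x i ω) ^ 2} with hB1
  set B2 : Fin n → Set Ω := fun i => {ω | τ * √(∑ j, weights H (others ω i) (x i ω) j ^ 2)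
      < |∑ j, weights H (others ω i) (x i ω) j * (y j ω - combine v a (x j ω))|} with hB2
  set B3 : Fin n → Set Ω := fun i => {ω | τ * √(σ2 + 1) * √(errorBound H lam v (others ω i)
        (dualCoeff H (others ω i) fun j => combine v a (x j ω)) S)
      < |∑ j : {j : Fin n // j ≠ i}, kern H (x j ω) (x i ω) *
          dualCoeff H (others ω i) (fun j => combine v a (x j ω)) j
        - combine v S (x i ω)|} with hB3
  set N : Set Ω := {ω | ¬ ∀ i, (y i ω = 1 ∨ y i ω = -1) ∧
    |combine v S (x i ω)| ≤ supNorm μ (survivalFun lam v a n αL αU)} with hN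
  have hN0 : P N = 0 := by
    have h1 : ∀ i, ∀ᵐ ω ∂P, (y i ω = 1 ∨ y i ω = -1) ∧
        |combine v S (x i ω)| ≤ supNorm μ (survivalFun lam v a n αL αU) := fun i => by
      have h2 : ∀ᵐ z ∂(P.map (x i)),
          |combine v S z| ≤ supNorm μ (survivalFun lam v a n αL αU) := by
        rw [hs.law i]
        exact ae_abs_le_supNorm hA.survival_bounded
      filter_upwards [hs.label i, ae_of_ae_map (hs.measurable_x i).aemeasurable h2] with ω h3 h4
      exact ⟨h3, h4⟩
    exact ae_iff.1 (ae_all_iff.2 h1)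
  have hsub : {ω | (αL • ContinuousLinearMap.id ℝ (EuclideanSpace ℝ (Fin n))
        ≤ residualGram H v p (x · ω) ∧
      residualGram H v p (x · ω) ≤ αU • ContinuousLinearMap.id ℝ (EuclideanSpace ℝ (Fin n))) ∧
      ∀ i, (αU - αL) / (αU + αL) + 2 / n * looDeviation v p (x · ω) i ≤ c}
      ⊆ {ω | SolutionsCoincide H (x · ω) (y · ω)} ∪ (N ∪ ⋃ i, (B1 i ∪ (B2 i ∪ B3 i))) := by
    rintro ω ⟨⟨hL, hU⟩, hc⟩
    by_cases hbad : ω ∈ N ∪ ⋃ i, (B1 i ∪ (B2 i ∪ B3 i))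
    · exact Or.inr hbad
    left
    simp only [Set.mem_union, Set.mem_iUnion, not_or, not_exists] at hbad
    obtain ⟨hbN, hbad⟩ := hbad
    have hgood := not_not.1 hbN
    have hR := ResGramBounds.of_residualGram h hp hL hU
    refine hR.solutionsCoincide h.nonneg h0 (fun i => (hgood i).1) fun i => ?_
    obtain ⟨hb1, hb2, hb3⟩ := hbad i
    simp only [hB1, hB2, hB3, Set.mem_ofPred_eq, not_lt] at hb1 hb2 hb3
    have hRi := hR.leaveOneOut i
    -- Only $n-1$ points remain, but the covariance is still compared with $n$ times the identity.
    have hcov : (αU - αL) / (αU + αL) + 2 / n * covDeviation v p (others ω i) n ≤ c := hc i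
    have hθ : covDeviation v p (others ω i) n ≤ (n : ℝ) / 4 := by
      have h1 : 2 / n * covDeviation v p (others ω i) n ≤ 1 / 2 := by linarith [hA.c_le]
      rw [div_mul_eq_mul_div, div_le_iff₀ hn'] at h1
      linarith
    have hD := hRi.errorBound_le h.nonneg h0 hle hn0 hcov hA.c_le a (β := b) (by
      rw [hb]
      exact h.sum_sq_le_supNorm hp _ hA.bias_bounded)
    have hQ := hRi.norm_weights_le h.nonneg h0 hle hU3 hn' hθ (x i ω)
    -- The factor $4$ comes from $\alpha_U+\alpha_L\le4\alpha_L$.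
    have hrow : √(∑ j : {j : Fin n // j ≠ i}, resKern H lam v p (x j ω) (x i ω) ^ 2) / αL
        ≤ 4 * ((αU - αL) / (αU + αL)) := by
      calc _ ≤ (αU - αL) / αL := by
            have := hR.sqrt_sum_sq_le hle i
            gcongr
        _ ≤ _ := by
            rw [mul_div_assoc', div_le_div_iff₀ h0 (by linarith)]
            nlinarith
    have hsplit : ∑ j : {j : Fin n // j ≠ i}, weights H (others ω i) (x i ω) j * y j ω
        = ∑ j : {j : Fin n // j ≠ i}, kern H (x j ω) (x i ω) *
          dualCoeff H (others ω i) (fun j => combine v a (x j ω)) j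
        + ∑ j, weights H (others ω i) (x i ω) j * (y j ω - combine v a (x j ω)) := by
      have := sum_weights_mul (H := H) (u := others ω i) (x i ω) fun j => combine v a (x j ω)
      rw [hothers] at this ⊢
      simp only at this ⊢
      rw [← this, ← Finset.sum_add_distrib]
      exact Finset.sum_congr rfl fun j _ => by ring
    change |∑ j : {j : Fin n // j ≠ i}, weights H (others ω i) (x i ω) j * y j ω| < 1
    rw [hsplit]
    refine abs_prediction_lt_one (w := √(σ2 + 1)) (N := n) (R := p) (L := Real.log n)
      (Λ := lam p * n / αL) hκ ?_ hb0 hρ0 (hρ0.trans hρc)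
      (div_nonneg (mul_nonneg (h.nonneg p) hn'.le) h0.le) ?_ hn' (Nat.cast_nonneg p)
      (q := √(∑ ℓ : Fin p, v ℓ (x i ω) ^ 2)) ?_ (hQ.trans (by gcongr)) hD
      (by rw [hb]; exact hA.bias_le) (hgood i).2 hb3 hb2
    · exact Real.one_le_sqrt.2 (by linarith [σ2.coe_nonneg])
    · rw [div_mul_eq_mul_div (lam p * n)]
      exact hsum
    · rw [Real.sq_sqrt (by positivity)]
      exact Real.sqrt_le_sqrt hb1
  have hBi : ∀ i, P (B1 i ∪ (B2 i ∪ B3 i))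
      ≤ ENNReal.ofReal (Real.exp (-p) + 4 * Real.exp (-(τ ^ 2 / 2))) := fun i => by
    refine (measure_union_le _ _).trans ((add_le_add (hs.measure_lt_sum_sq_le h hf hp i)
      ((measure_union_le _ _).trans (add_le_add (hs.measure_lt_abs_weighted_noise_le hη h hτ0 i)
        (hs.measure_lt_abs_bias_le hη h hf hp S hτ0 i)))).trans (le_of_eq ?_))
    rw [← ENNReal.ofReal_add (by positivity) (by positivity),
      ← ENNReal.ofReal_add (by positivity) (by positivity)]
    congr 1; ring
  have hbad : P.real (N ∪ ⋃ i, (B1 i ∪ (B2 i ∪ B3 i)))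
      ≤ n * (Real.exp (-p) + 4 * Real.exp (-(τ ^ 2 / 2))) := by
    refine ENNReal.toReal_le_of_le_ofReal (by positivity) ?_
    calc _ ≤ P N + P (⋃ i, (B1 i ∪ (B2 i ∪ B3 i))) := measure_union_le _ _
      _ ≤ 0 + ∑ _i : Fin n, ENNReal.ofReal (Real.exp (-p) + 4 * Real.exp (-(τ ^ 2 / 2))) :=
          add_le_add hN0.le ((measure_iUnion_fintype_le _ _).trans
            (Finset.sum_le_sum fun i _ => hBi i))
      _ = _ := by
          rw [zero_add, Finset.sum_const, Finset.card_univ, Fintype.card_fin, nsmul_eq_mul,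
            ENNReal.ofReal_mul hn'.le, ENNReal.ofReal_natCast]
  -- Two two-sided tails per point amount to $4/n^2$ in total, which is below $3/n$ once $n\ge2$.
  have hfin : (n : ℝ) * (4 * Real.exp (-(τ ^ 2 / 2))) ≤ 3 / n := by
    have h2 : (2 : ℝ) ≤ n := by exact_mod_cast hn
    rw [hexp, show (n : ℝ) * (4 * (1 / (n : ℝ) ^ 3)) = 4 / (n : ℝ) ^ 2 by field_simp,
      div_le_div_iff₀ (by positivity) hn']
    nlinarith
  -- Monotonicity and subadditivity hold for the outer measure, so neither the good event nor the
  -- conclusion has to be measurable.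
  have hE := hA.concentration.trans ((measureReal_mono hsub (measure_ne_top _ _)).trans
    (measureReal_union_le _ _))
  linarith

end Main

end SVP

theorem theorem2 (σ2 : ℝ≥0) (κ : ℝ) (hκ : 0 < κ) :
    ∃ ε : ℝ, 0 < ε ∧
      ∀ (X : Type*) [MeasurableSpace X] (μ : Measure X) [IsProbabilityMeasure μ]
        (H : Type*) [NormedAddCommGroup H] [InnerProductSpace ℝ H] [CompleteSpace H]
        [RKHS ℝ H X ℝ] (lam : ℕ → ℝ) (v : ℕ → X → ℝ) (p n : ℕ) (a : Fin p → ℝ)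
        (Ω : Type*) [MeasurableSpace Ω] (P : Measure Ω) [IsProbabilityMeasure P]
        (x : Fin n → Ω → X) (y : Fin n → Ω → ℝ) (δ αL αU c b : ℝ),
        0 < n →
        SVP.IsMercerSystem H μ lam v →
        SVP.IndepSubGaussianFeatures μ lam v σ2 →
        SVP.IsSample P μ (SVP.combine v a) x y →
        SVP.SamplingAssumption H P μ lam v a x δ αL αU c κ →
        b = SVP.supNorm μ (SVP.biasFun lam v a n αL αU) →
        0 < b →
        1 / b * √(p * Real.log n / n) + (αU - αL) / (αU + αL) * (√(Real.log n) / b)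
            + √(lam p * n * Real.log n / αL) + c * √(Real.log n) ≤ ε →
        1 - δ - n * Real.exp (-p) - 3 / n ≤
          P.real {ω | SVP.SolutionsCoincide H (x · ω) (y · ω)} := by
  refine ⟨1 / (144 * √(σ2 + 1) * κ), by positivity, ?_⟩
  intro X _ μ _ H _ _ _ _ lam v p n a Ω _ P _ x y δ αL αU c b hn h hf hs hA hb hb0 hsum
  rcases Nat.lt_or_ge n 2 with h2 | h2
  -- For $n=1$ the claimed lower bound is negative because of the term $3/n$.
  · obtain rfl : n = 1 := by omega
    refine le_trans ?_ measureReal_nonneg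
    have h3 := hA.delta_pos
    have h4 := Real.exp_pos (-(p : ℝ))
    norm_num
    linarith
  · exact SVP.le_measureReal_solutionsCoincide h hf hs hκ h2 hA hb hb0 hsum
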